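/- Setting. All logarithms are natural. Let $n\ge 1$, $L\ge 2$, $M\ge 1$ be integers, $P,\sigma>0$, $\mathsf{snr}=P/\sigma^2$, $\mathcal C_\alpha=\tfrac12\log(1+\alpha\,\mathsf{snr})$ for $0\le\alpha\le 1$, and $\mathcal C=\mathcal C_1$. Let $\mathcal B_{M,L}\subset\mathbb R^{ML}$ be the set of the $M^L$ vectors that consist of $L$ sections of length $M$, each section having exactly one non-zero entry, equal to $\sqrt{nP/L}$ (flat power allocation). The dictionary $A\in\mathbb R^{n\times ML}$ has i.i.d. $\mathcal N(0,1/n)$ entries, the noise $z\in\mathbb R^n$ has i.i.d. $\mathcal N(0,\sigma^2)$ entries, the message $\beta$ is uniform on $\mathcal B_{M,L}$, and $A,z,\beta$ are independent. The channel output is $y=A\beta+z$. A maximum-likelihood decoder returns a minimiser $\hat\beta$ of $\|y-A\beta'\|^2$ over $\beta'\in\mathcal B_{M,L}$ (ties may be broken in any way). The section error rate $\mathcal E_{\mathsf{sec}}$ is the fraction of the $L$ sections on which $\hat\beta$ and $\beta$ differ. The rate $R$ is defined by $L\log M=nR$. For $x\in\mathbb R$ and $0\le s<1$ put $D_1(x,s)=\max_{0\le\lambda\le1}\{\lambda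 x+\tfrac12\log(1-\lambda^2 s)\}$, and let $$\mathsf a^*_L(\mathsf{snr})=\max_{\alpha\in\{\frac1L,\dots,1-\frac1L\}}\frac{R\log\binom{L}{L\alpha}}{D_1\!\left(\mathcal C_\alpha-\alpha\mathcal C,\ \frac{\alpha(1-\alpha)\mathsf{snr}}{1+\alpha\,\mathsf{snr}}\right)L\log L},$$ $$g(x)=\sqrt{1+4x^2}-1,\qquad w(\mathsf{snr})=\frac{\mathsf{snr}}{2(1+\mathsf{snr})^2\sqrt{4+\mathsf{snr}^3/(1+\mathsf{snr})}},$$ $$h(\epsilon,\Delta)=\min\left\{\epsilon\,\Delta\,w(\mathsf{snr}),\ \tfrac14\,g\!\left(\frac{\Delta}{2\sqrt{\mathsf{snr}}}\right)\right\}.$$ Theorem (Gaussian SPARC, optimal decoding). Assume that $M=L^{\mathsf a}$ for a real number $\mathsf a\ge\mathsf a^*_L(\mathsf{snr})$, and that $\Delta=\mathcal C-R>0$. Then for every $\epsilon>0$ the section error rate of any maximum-likelihood decoder satisfies $$\mathbb P(\mathcal E_{\mathsf{sec}}\ge\epsilon)=e^{-nE(\epsilon,R)}\quad\text{with}\quad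 E(\epsilon,R)\ \ge\ h(\epsilon,\Delta)-\frac{\log(2L)}{n},$$ where $E(\epsilon,R)\in(-\infty,+\infty]$, the value $+\infty$ corresponding to probability $0$; equivalently, $\mathbb P(\mathcal E_{\mathsf{sec}}\ge\epsilon)\le 2L\,e^{-n h(\epsilon,\Delta)}$. -/

import Mathlib

open MeasureTheory ProbabilityTheory
open scoped ENNReal NNReal

noncomputable section

namespace SPARC

/-! ### Exponents and constants (natural logarithms throughout) -/

/-- AWGN capacity `C = (1/2) log (1 + snr)`, in nats. -/
def capacity (snr : ℝ) : ℝ := 1 / 2 * Real.log (1 + snr)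

/-- `D₁(Δ, s) = max_{0 ≤ t ≤ 1} { t Δ + (1/2) log (1 - t² s) }`, for `0 ≤ s < 1`. -/
def D1 (Δ s : ℝ) : ℝ :=
  sSup ((fun t : ℝ => t * Δ + 1 / 2 * Real.log (1 - t ^ 2 * s)) '' Set.Icc 0 1)

/-- The quotient that is maximised over `α ∈ {1/L, …, 1 - 1/L}` in the definition of `a*_L(snr)`;
here `α = k / L`, and `capacity (α * snr)` is `C_α = (1/2) log (1 + α snr)`. -/
def sectionSizeRatio (L : ℕ) (snr R : ℝ) (k : ℕ) : ℝ :=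
  let α : ℝ := (k : ℝ) / L
  R * Real.log (L.choose k) /
    (D1 (capacity (α * snr) - α * capacity snr) (α * (1 - α) * snr / (1 + α * snr))
      * L * Real.log L)

/-- `a*_L(snr)` (which also depends on the rate `R`), the maximum over `α = k / L`, `1 ≤ k ≤ L - 1`,
for `L ≥ 2`. -/
def aStar (L : ℕ) (snr R : ℝ) : ℝ :=
  sSup (sectionSizeRatio L snr R '' Set.Ioo 0 L)

/-- `g(x) = √(1 + 4 x²) - 1`. -/
def g (x : ℝ) : ℝ := Real.sqrt (1 + 4 * x ^ 2) - 1

/-- `w(snr) = snr / (2 (1 + snr)² √(4 + snr³ / (1 + snr)))`. -/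
def w (snr : ℝ) : ℝ :=
  snr / (2 * (1 + snr) ^ 2 * Real.sqrt (4 + snr ^ 3 / (1 + snr)))

/-- `h(ε, Δ) = min { ε Δ w(snr), (1/4) g(Δ / (2 √snr)) }`. -/
def h (snr ε Δ : ℝ) : ℝ :=
  min (ε * Δ * w snr) (1 / 4 * g (Δ / (2 * Real.sqrt snr)))

/-! ### The code

The `M L` columns of the dictionary are indexed by pairs (section, column within the section). -/

/-- The length-`ML` vector whose non-zero entry in section `ℓ` has value `c` and sits in
position `m ℓ` of that section. -/
def messageVector {L M : ℕ} (c : ℝ) (m : Fin L → Fin M) : Fin L × Fin M → ℝ :=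
  fun p => if p.2 = m p.1 then c else 0

open Classical in
/-- The set `B_{M,L}` of valid message vectors, with all non-zero coefficients equal to `c`. -/
def messageSet (L M : ℕ) (c : ℝ) : Finset (Fin L × Fin M → ℝ) :=
  Finset.univ.image (messageVector c)

/-- A vector is a valid message vector exactly when each of its sections has one entry equal to `c`
and all other entries equal to `0`. -/
theorem mem_messageSet {L M : ℕ} {c : ℝ} (β : Fin L × Fin M → ℝ) :
    β ∈ messageSet L M c ↔ ∀ l, ∃ j, β (l, j) = c ∧ ∀ i, i ≠ j → β (l, i) = 0 := by
  classical
  simp only [messageSet, Finset.mem_image, Finset.mem_univ, true_and]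
  constructor
  · rintro ⟨m, rfl⟩ l
    exact ⟨m l, by simp [messageVector], fun i hi => by simp [messageVector, hi]⟩
  · intro hβ
    choose m hm h0 using hβ
    refine ⟨m, ?_⟩
    ext ⟨l, i⟩
    by_cases hi : i = m l
    · subst hi
      simp [messageVector, hm]
    · simp [messageVector, hi, h0 l i hi]

/-- There are `M ^ L` valid message vectors. -/
theorem card_messageSet {L M : ℕ} {c : ℝ} (hc : c ≠ 0) : (messageSet L M c).card = M ^ L := by
  classical
  rw [messageSet, Finset.card_image_of_injective]
  · simp
  · intro m m' hmm
    funext l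
    by_contra hne
    have := congrFun hmm (l, m l)
    simp [messageVector, hne, hc] at this

/-- The non-zero coefficient of the flat power allocation, `√(n P / L)`. -/
def flatCoeff (n L : ℕ) (P : ℝ) : ℝ := Real.sqrt (n * P / L)

/-- Codeword `A β`. -/
def codeword {n L M : ℕ} (A : Fin n → Fin L × Fin M → ℝ) (β : Fin L × Fin M → ℝ) : Fin n → ℝ :=
  (Matrix.of A).mulVec β

/-- Squared Euclidean distance `‖y - A β‖²`. -/
def sqDist {n L M : ℕ} (A : Fin n → Fin L × Fin M → ℝ) (y : Fin n → ℝ)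
    (β : Fin L × Fin M → ℝ) : ℝ :=
  ∑ i, (y i - codeword A β i) ^ 2

/-- A maximum-likelihood decoder: a map that returns, for every dictionary `A` and every channel
output `y`, some minimiser of `‖y - A β‖²` over the valid message vectors `β`
(ties may be broken in any way). -/
def IsMLDecoder {n L M : ℕ} (c : ℝ)
    (dec : (Fin n → Fin L × Fin M → ℝ) → (Fin n → ℝ) → (Fin L × Fin M → ℝ)) : Prop :=
  ∀ A y, dec A y ∈ messageSet L M c ∧ ∀ β ∈ messageSet L M c, sqDist A y (dec A y) ≤ sqDist A y β

open Classical in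
/-- Section error rate: the fraction of sections on which the two vectors differ. -/
def sectionErrorRate {L M : ℕ} (β βhat : Fin L × Fin M → ℝ) : ℝ :=
  1 / (L : ℝ) * ∑ l : Fin L, if (fun j => βhat (l, j)) ≠ (fun j => β (l, j)) then 1 else 0

/-- Law of the dictionary: `n × ML` entries, i.i.d. `N(0, 1/n)`. -/
def dictionaryLaw (n L M : ℕ) : Measure (Fin n → Fin L × Fin M → ℝ) :=
  Measure.pi fun _ => Measure.pi fun _ => gaussianReal 0 (n : ℝ≥0)⁻¹

/-- Law of the channel noise: `n` coordinates, i.i.d. `N(0, σ²)`. -/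
def noiseLaw (n : ℕ) (σ : ℝ) : Measure (Fin n → ℝ) :=
  Measure.pi fun _ => gaussianReal 0 (Real.toNNReal (σ ^ 2))

/-- Probability that the section error rate is at least `ε` when the message vector `β` is sent
over the AWGN channel, `y = A β + noise`, with dictionary and noise random and independent. -/
def excessProbOf {n L M : ℕ} (σ : ℝ)
    (dec : (Fin n → Fin L × Fin M → ℝ) → (Fin n → ℝ) → (Fin L × Fin M → ℝ))
    (ε : ℝ) (β : Fin L × Fin M → ℝ) : ℝ≥0∞ :=
  ((dictionaryLaw n L M).prod (noiseLaw n σ))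
    {p | ε ≤ sectionErrorRate β (dec p.1 (codeword p.1 β + p.2))}

/-- `P(section error rate ≥ ε)`, averaged over a uniformly chosen message vector
(there are `M ^ L` of them), the dictionary and the noise. -/
def excessProb {n L M : ℕ} (σ c : ℝ)
    (dec : (Fin n → Fin L × Fin M → ℝ) → (Fin n → ℝ) → (Fin L × Fin M → ℝ)) (ε : ℝ) : ℝ≥0∞ :=
  ((M : ℝ≥0∞) ^ L)⁻¹ * ∑ β ∈ messageSet L M c, excessProbOf σ dec ε β

end SPARC

end

namespace SPARC

/-! ### Gaussian vectors and Gaussian integrals. -/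

section Gaussian

/-! Split the error event by the number k of wrong sections and put α = k/L. For each k ≥ 1 with k/L
≥ ε, the probability that some message at distance k is at least as likely as the true one is at
most 2 exp(-n h) (`weightEvent_le_two_mul_exp`). There are at most L such k, whence the factor 2L.

For fixed k the tool is a two-level Gallager bound: likelihood ratios are summed over the
competitors wrong exactly on a set U, raised to the power lam, summed over U, and raised to the
power rho. The part X_U of the true codeword X is split as αX + (X_U - αX). The two pieces are
independent, and the first does not depend on U. Hence the competitor is averaged inside the power
lam, the second piece inside the power rho, and αX and the noise last, each by a one-dimensional
Gaussian integral. Instead of conditional Jensen inequalities, tangent lines to the two concave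
powers are used (`one_le_tangent`), so that only plain expectations occur. The result is
`weight_event_le`, with exponent `rowExponent`.

Two choices of parameters suffice. In the tilted choice lam is a near-maximiser l in `D1`. The
hypothesis on a says log C(L,k) ≤ n D1 (`log_choose_le`), which pays for the choice of U and leaves
the exponent μαΔ - μ²α² snr/2 for every μ = rho lam ≤ l. As l ≥ (1 + snr) w (`exists_maximiser`),
this reaches h unless snr < 1/10 and Δ > 7 w α snr (`exists_tilt`).

In that remaining case rho = 1, an ordinary union bound over U. With αξ = C_α - αC its exponent is
α(ξ + Δ)²/(2 snr), and log C(L,k) must be absorbed. For α ≥ 1/20 the hypothesis on a at k itself is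
enough; for α < 1/20 the hypothesis at k = 1 is combined with C(L,k) ≤ L^k/k!, at the cost of the
factor 2 in 2L. -/

theorem lintegral_pi_prod {ι Ω : Type*} [Fintype ι] [MeasurableSpace Ω] (μ : Measure Ω)
    [IsProbabilityMeasure μ] {f : Ω → ℝ≥0∞} (hf : Measurable f) :
    ∫⁻ x, ∏ i, f (x i) ∂(Measure.pi fun _ : ι => μ) = (∫⁻ y, f y ∂μ) ^ Fintype.card ι := by
  have hind : iIndepFun (fun i (x : ι → Ω) => f (x i)) (Measure.pi fun _ : ι => μ) :=
    iIndepFun_pi (X := fun _ => f) fun _ => hf.aemeasurable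
  rw [lintegral_prod_eq_prod_lintegral_of_indepFun Finset.univ _ hind
    fun i => hf.comp (measurable_pi_apply i)]
  have h (i : ι) : ∫⁻ x : ι → Ω, f (x i) ∂(Measure.pi fun _ : ι => μ) = ∫⁻ y, f y ∂μ :=
    (measurePreserving_eval (fun _ : ι => μ) i).lintegral_comp hf
  simp [h]

/-- Uncorrelated linear functionals of an i.i.d. centred Gaussian vector are independent
Gaussians. -/
theorem map_linear_gaussian {J T : Type*} [Fintype J] [Fintype T] (τ : ℝ≥0) (w : T → J → ℝ)
    (horth : ∀ t t', t ≠ t' → ∑ j, w t j * w t' j = 0) :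
    iIndepFun (fun t (r : J → ℝ) => ∑ j, w t j * r j)
        (Measure.pi fun _ : J => gaussianReal 0 τ) ∧
      ∀ t, (Measure.pi fun _ : J => gaussianReal 0 τ).map (fun r => ∑ j, w t j * r j) =
        gaussianReal 0 (Real.toNNReal (τ * ∑ j, w t j ^ 2)) := by
  classical
  set μ := Measure.pi fun _ : J => gaussianReal 0 τ with hμ
  have hind : iIndepFun (fun j (r : J → ℝ) => r j) μ :=
    iIndepFun_pi (X := fun _ => id) fun _ => aemeasurable_id
  have hlaw (j : J) : μ.map (fun r : J → ℝ => r j) = gaussianReal 0 τ :=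
    (measurePreserving_eval (fun _ : J => gaussianReal 0 τ) j).map_eq
  have hg1 (j : J) : HasGaussianLaw (fun r : J → ℝ => r j) μ :=
    ⟨by rw [hlaw]; infer_instance⟩
  have hg : HasGaussianLaw (fun r : J → ℝ => (r · : J → ℝ)) μ := iIndepFun.hasGaussianLaw hg1 hind
  have hgT : HasGaussianLaw (fun r : J → ℝ => fun t => ∑ j, w t j * r j) μ := by
    have := hg.map_fun (ContinuousLinearMap.pi fun t : T =>
      ∑ j, w t j • (ContinuousLinearMap.proj j : (J → ℝ) →L[ℝ] ℝ))
    simpa using this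
  have hmem (t : T) (j : J) : MemLp (fun r : J → ℝ => w t j * r j) 2 μ :=
    (hg1 j).memLp_two.const_mul _
  have hcov1 (j j' : J) : cov[fun r : J → ℝ => r j, fun r => r j'; μ] =
      if j = j' then (τ : ℝ) else 0 := by
    split_ifs with h
    · subst h
      rw [covariance_self (Measurable.aemeasurable (by fun_prop))]
      have := variance_map (X := fun x : ℝ => x) (Y := fun r : J → ℝ => r j) (μ := μ)
        (by fun_prop) (Measurable.aemeasurable (by fun_prop))
      rw [hlaw, variance_fun_id_gaussianReal] at this
      exact this.symm
    · exact (hind.indepFun h).covariance_eq_zero (hg1 j).memLp_two (hg1 j').memLp_two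
  have hcov (t t' : T) : cov[fun r : J → ℝ => ∑ j, w t j * r j, fun r => ∑ j, w t' j * r j; μ] =
      τ * ∑ j, w t j * w t' j := by
    rw [covariance_fun_sum_fun_sum (hmem t) (hmem t')]
    simp only [covariance_const_mul_left, covariance_const_mul_right, hcov1, mul_ite, mul_zero,
      Finset.sum_ite_eq, Finset.mem_univ, if_true, Finset.mul_sum]
    exact Finset.sum_congr rfl fun j _ => by ring
  refine ⟨hgT.iIndepFun_of_covariance_eq_zero fun t t' h => by
    rw [hcov, horth t t' h, mul_zero], fun t => ?_⟩
  rw [(hgT.eval t).map_eq_gaussianReal]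
  congr 1
  · rw [integral_finsetSum _ fun j _ => (hmem t j).integrable (by norm_num)]
    refine Finset.sum_eq_zero fun j _ => ?_
    rw [integral_const_mul]
    have : ∫ r : J → ℝ, r j ∂μ = ∫ x, x ∂(μ.map fun r : J → ℝ => r j) := by
      rw [integral_map (Measurable.aemeasurable (by fun_prop)) (by fun_prop)]
    rw [this, hlaw, integral_id_gaussianReal, mul_zero]
  · rw [← covariance_self (Measurable.aemeasurable (by fun_prop)), hcov]
    simp [sq]

/-- The Gaussian integral `E exp (d - γ/2 (u + X)²)` for `X ~ N(0, t)`. -/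
theorem lintegral_exp_sq_gaussian (t : ℝ≥0) (γ u d : ℝ) (h : 0 < 1 + γ * t) :
    ∫⁻ x, ENNReal.ofReal (Real.exp (d - γ / 2 * (u + x) ^ 2)) ∂(gaussianReal 0 t) =
      ENNReal.ofReal (Real.exp
        (d - γ / 2 * u ^ 2 / (1 + γ * t) - 1 / 2 * Real.log (1 + γ * t))) := by
  rcases eq_or_ne t 0 with rfl | ht
  · rw [gaussianReal_zero_var, lintegral_dirac' _ (by fun_prop)]
    simp
  have ht' : (0 : ℝ) < t := by positivity
  -- Completing the square: the integrand times the N(0, t) density is a constant times the N(m, q)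
  -- density.
  set q : ℝ≥0 := ⟨t / (1 + γ * t), by positivity⟩ with hq
  have hqv : (q : ℝ) = t / (1 + γ * t) := rfl
  have hq0 : q ≠ 0 := by
    intro h0
    have : (q : ℝ) = 0 := by rw [h0]; rfl
    rw [hqv] at this
    exact (div_pos ht' h).ne' this
  set m : ℝ := -(γ * t * u) / (1 + γ * t) with hm
  set K := Real.exp (d - γ / 2 * u ^ 2 / (1 + γ * t) - 1 / 2 * Real.log (1 + γ * t))
  have key (x : ℝ) : gaussianPDF 0 t x * ENNReal.ofReal (Real.exp (d - γ / 2 * (u + x) ^ 2)) =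
      ENNReal.ofReal K * gaussianPDF m q x := by
    rw [gaussianPDF, gaussianPDF, ← ENNReal.ofReal_mul (gaussianPDFReal_nonneg _ _ _),
      ← ENNReal.ofReal_mul (Real.exp_pos _).le]
    congr 1
    rw [gaussianPDFReal, gaussianPDFReal, hqv]
    have hsq : √(2 * Real.pi * (t / (1 + γ * t))) =
        √(2 * Real.pi * t) * Real.exp (-(1 / 2 * Real.log (1 + γ * t))) := by
      rw [← mul_div_assoc, Real.sqrt_div (by positivity), div_eq_mul_inv, Real.exp_neg]
      congr 2
      rw [Real.sqrt_eq_rpow, Real.rpow_def_of_pos h]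
      ring_nf
    rw [hsq, mul_inv, ← Real.exp_neg, neg_neg]
    have h1 : (√(2 * Real.pi * t))⁻¹ * Real.exp (-(x - 0) ^ 2 / (2 * t)) *
        Real.exp (d - γ / 2 * (u + x) ^ 2) = (√(2 * Real.pi * t))⁻¹ *
        Real.exp (-(x - 0) ^ 2 / (2 * t) + (d - γ / 2 * (u + x) ^ 2)) := by
      rw [Real.exp_add]; ring
    rw [h1]
    have h2 (a b c e : ℝ) : Real.exp a * (e * Real.exp b * Real.exp c) =
        e * Real.exp (a + b + c) := by
      rw [Real.exp_add, Real.exp_add]; ring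
    rw [h2]
    congr 2
    have hne := h.ne'
    have hγ : γ = ((1 + γ * t) - 1) / t := by field_simp; ring
    rw [hm]
    generalize 1 + γ * (t : ℝ) = D at hne hγ ⊢
    subst hγ
    field_simp
    ring
  rw [gaussianReal_of_var_ne_zero _ ht,
    lintegral_withDensity_eq_lintegral_mul _ (measurable_gaussianPDF _ _) (by fun_prop)]
  simp only [Pi.mul_apply, key]
  rw [lintegral_const_mul _ (measurable_gaussianPDF _ _), lintegral_gaussianPDF_eq_one _ hq0,
    mul_one]

end Gaussian

/-! ### Joint law of the codeword pieces in one row of the dictionary. -/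

section RowLaw

theorem codeword_messageVector {n L M : ℕ} (c : ℝ) (A : Fin n → Fin L × Fin M → ℝ)
    (m : Fin L → Fin M) (i : Fin n) :
    codeword A (messageVector c m) i = c * ∑ l, A i (l, m l) := by
  simp [codeword, Matrix.mulVec, dotProduct, messageVector, Fintype.sum_prod_type,
    Finset.mul_sum, mul_comm]

theorem lintegral_channel {n L M : ℕ} (σ : ℝ) {f : (Fin L × Fin M → ℝ) × ℝ → ℝ≥0∞}
    (hf : Measurable f) :
    ∫⁻ p, ∏ i, f (p.1 i, p.2 i) ∂((dictionaryLaw n L M).prod (noiseLaw n σ)) =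
      (∫⁻ z, ∫⁻ r, f (r, z) ∂(Measure.pi fun _ => gaussianReal 0 (n : ℝ≥0)⁻¹)
        ∂(gaussianReal 0 (Real.toNNReal (σ ^ 2)))) ^ n := by
  have hmp := measurePreserving_arrowProdEquivProdArrow (Fin L × Fin M → ℝ) ℝ (Fin n)
    (fun _ => Measure.pi fun _ => gaussianReal 0 (n : ℝ≥0)⁻¹)
    (fun _ => gaussianReal 0 (Real.toNNReal (σ ^ 2)))
  have h := hmp.lintegral_comp
    (f := fun p : (Fin n → Fin L × Fin M → ℝ) × (Fin n → ℝ) => ∏ i, f (p.1 i, p.2 i))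
    (by fun_prop)
  rw [dictionaryLaw, noiseLaw, ← h]
  have h2 := lintegral_pi_prod (ι := Fin n) ((Measure.pi fun _ : Fin L × Fin M =>
    gaussianReal 0 (n : ℝ≥0)⁻¹).prod (gaussianReal 0 (Real.toNNReal (σ ^ 2)))) hf
  rw [Fintype.card_fin] at h2
  rw [← lintegral_prod_symm' _ hf, ← h2]
  rfl

/-- The three functionals x = αX, y = X_U - αX and x' = X'_U are uncorrelated, hence independent:
the value α = |U|/L makes x and y orthogonal, and x' uses columns disjoint from those of the true
message in U. -/
theorem lintegral_row {L M : ℕ} (hL : 0 < L) (τ : ℝ≥0) (b S α : ℝ) (m m' : Fin L → Fin M)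
    (U : Finset (Fin L)) (hU : ∀ l, m' l ≠ m l ↔ l ∈ U) (hα : α = U.card / L)
    (hS : S = τ * (b ^ 2 * L))
    {F : ℝ → ℝ → ℝ → ℝ≥0∞} (hF : Measurable fun q : ℝ × ℝ × ℝ => F q.1 q.2.1 q.2.2) :
    ∫⁻ r, F (α * (b * ∑ l, r (l, m l)))
        (b * ∑ l ∈ U, r (l, m l) - α * (b * ∑ l, r (l, m l))) (b * ∑ l ∈ U, r (l, m' l))
        ∂(Measure.pi fun _ : Fin L × Fin M => gaussianReal 0 τ) =
      ∫⁻ x, ∫⁻ y, ∫⁻ x', F x y x' ∂(gaussianReal 0 (Real.toNNReal (α * S)))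
        ∂(gaussianReal 0 (Real.toNNReal (α * (1 - α) * S)))
        ∂(gaussianReal 0 (Real.toNNReal (α ^ 2 * S))) := by
  classical
  have hL' : (L : ℝ) ≠ 0 := by positivity
  -- Coefficient vectors of x, y and x' over the entries of the row.
  set w : Fin 3 → Fin L × Fin M → ℝ := ![fun p => if p.2 = m p.1 then α * b else 0,
    fun p => if p.2 = m p.1 then ((if p.1 ∈ U then 1 else 0) - α) * b else 0,
    fun p => if p.2 = m' p.1 then (if p.1 ∈ U then b else 0) else 0] with hw
  have hcardU : ∑ l : Fin L, (if l ∈ U then (1 : ℝ) else 0) = α * L := by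
    rw [hα]; field_simp; simp
  have h01 : ∑ j, w 0 j * w 1 j = 0 := by
    have : ∀ l : Fin L, ∑ i : Fin M, w 0 (l, i) * w 1 (l, i) =
        α * b * (((if l ∈ U then 1 else 0) - α) * b) := fun l => by simp [hw]
    rw [Fintype.sum_prod_type]
    simp only [this]
    rw [← Finset.mul_sum, ← Finset.sum_mul, Finset.sum_sub_distrib, hcardU]
    simp [mul_comm]
  have h02 : ∑ j, w 0 j * w 2 j = 0 := by
    refine Finset.sum_eq_zero fun p _ => ?_
    by_cases hp : p.2 = m' p.1
    · by_cases hpU : p.1 ∈ U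
      · simp [hw, hp, (hU p.1).2 hpU]
      · simp [hw, hpU]
    · simp [hw, hp]
  have h12 : ∑ j, w 1 j * w 2 j = 0 := by
    refine Finset.sum_eq_zero fun p _ => ?_
    by_cases hp : p.2 = m' p.1
    · by_cases hpU : p.1 ∈ U
      · simp [hw, hp, (hU p.1).2 hpU]
      · simp [hw, hpU]
    · simp [hw, hp]
  have hn0 : ∑ j, w 0 j ^ 2 = α ^ 2 * (b ^ 2 * L) := by
    rw [Fintype.sum_prod_type]
    simp [hw, ite_pow]
    ring
  have hn1 : ∑ j, w 1 j ^ 2 = α * (1 - α) * (b ^ 2 * L) := by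
    have : ∀ l : Fin L, ∑ i : Fin M, w 1 (l, i) ^ 2 =
        (if l ∈ U then 1 else 0) * ((1 - 2 * α) * b ^ 2) + α ^ 2 * b ^ 2 := fun l => by
      simp [hw, ite_pow]
      split_ifs <;> ring
    rw [Fintype.sum_prod_type]
    simp only [this]
    rw [Finset.sum_add_distrib, ← Finset.sum_mul, hcardU]
    simp
    ring
  have hn2 : ∑ j, w 2 j ^ 2 = α * (b ^ 2 * L) := by
    have : ∀ l : Fin L, ∑ i : Fin M, w 2 (l, i) ^ 2 =
        (if l ∈ U then 1 else 0) * b ^ 2 := fun l => by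
      simp [hw, ite_pow]
    rw [Fintype.sum_prod_type]
    simp only [this]
    rw [← Finset.sum_mul, hcardU]
    ring
  have horth : ∀ t t', t ≠ t' → ∑ j, w t j * w t' j = 0 := by
    intro t t' htt'
    fin_cases t <;> fin_cases t'
    · exact absurd rfl htt'
    · exact h01
    · exact h02
    · exact (Finset.sum_congr rfl fun _ _ => mul_comm _ _).trans h01
    · exact absurd rfl htt'
    · exact h12
    · exact (Finset.sum_congr rfl fun _ _ => mul_comm _ _).trans h02
    · exact (Finset.sum_congr rfl fun _ _ => mul_comm _ _).trans h12
    · exact absurd rfl htt'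
  obtain ⟨hind, hlaw⟩ := map_linear_gaussian τ w horth
  set μ := Measure.pi fun _ : Fin L × Fin M => gaussianReal 0 τ with hμ
  have e0 (r : Fin L × Fin M → ℝ) : ∑ j, w 0 j * r j = α * (b * ∑ l, r (l, m l)) := by
    simp [hw, Fintype.sum_prod_type, Finset.mul_sum, mul_assoc]
  have e1 (r : Fin L × Fin M → ℝ) : ∑ j, w 1 j * r j =
      b * ∑ l ∈ U, r (l, m l) - α * (b * ∑ l, r (l, m l)) := by
    have : ∀ l : Fin L, ∑ i : Fin M, w 1 (l, i) * r (l, i) =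
        b * (if l ∈ U then r (l, m l) else 0) - α * (b * r (l, m l)) := fun l => by
      simp [hw]
      split_ifs <;> ring
    rw [Fintype.sum_prod_type]
    simp only [this]
    rw [Finset.sum_sub_distrib, ← Finset.mul_sum, ← Finset.mul_sum, ← Finset.mul_sum]
    simp
  have e2 (r : Fin L × Fin M → ℝ) : ∑ j, w 2 j * r j = b * ∑ l ∈ U, r (l, m' l) := by
    simp [hw, Fintype.sum_prod_type, Finset.mul_sum]
  have hmeas (t : Fin 3) : Measurable fun r : Fin L × Fin M → ℝ => ∑ j, w t j * r j := by
    fun_prop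
  have hi12 := (indepFun_iff_map_prod_eq_prod_map_map (hmeas 1).aemeasurable
    (hmeas 2).aemeasurable).1 (hind.indepFun (show (1 : Fin 3) ≠ 2 by decide))
  have hi0 := (indepFun_iff_map_prod_eq_prod_map_map (hmeas 0).aemeasurable
    ((hmeas 1).prodMk (hmeas 2)).aemeasurable).1
    (hind.indepFun_prodMk hmeas 1 2 0 (by decide) (by decide)).symm
  rw [hi12, hlaw, hlaw, hlaw, hn0, hn1, hn2] at hi0
  have hr : (τ : ℝ) * (α ^ 2 * (b ^ 2 * L)) = α ^ 2 * S ∧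
      (τ : ℝ) * (α * (1 - α) * (b ^ 2 * L)) = α * (1 - α) * S ∧
      (τ : ℝ) * (α * (b ^ 2 * L)) = α * S := by
    rw [hS]; refine ⟨?_, ?_, ?_⟩ <;> ring
  rw [hr.1, hr.2.1, hr.2.2] at hi0
  calc _ = ∫⁻ r, (fun q : ℝ × ℝ × ℝ => F q.1 q.2.1 q.2.2)
        (∑ j, w 0 j * r j, ∑ j, w 1 j * r j, ∑ j, w 2 j * r j) ∂μ := by
        simp only [e0, e1, e2]
    _ = ∫⁻ q, F q.1 q.2.1 q.2.2 ∂(μ.map fun r =>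
        (∑ j, w 0 j * r j, ∑ j, w 1 j * r j, ∑ j, w 2 j * r j)) := by
        rw [lintegral_map hF ((hmeas 0).prodMk ((hmeas 1).prodMk (hmeas 2)))]
    _ = _ := by
        rw [hi0, lintegral_prod _ hF.aemeasurable]
        refine lintegral_congr fun x => ?_
        rw [lintegral_prod _ (by fun_prop)]

end RowLaw

/-! ### Linearisation of the two nested concave powers. -/

section Tangent

/-- Tangent-line bound for the concave power `y ↦ y ^ t` at the point `N * exp b`. -/
theorem rpow_le_tangent {y N t : ℝ} (b : ℝ) (hy : 0 ≤ y) (hN : 0 < N) (h0 : 0 ≤ t) (h1 : t ≤ 1) :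
    y ^ t ≤ N ^ t * ((1 - t) * Real.exp (t * b) + t * N⁻¹ * (Real.exp ((t - 1) * b) * y)) := by
  have h := Real.geom_mean_le_arith_mean2_weighted (sub_nonneg.2 h1) h0 zero_le_one
    (show 0 ≤ y / N * Real.exp (-b) by positivity) (by ring)
  rw [Real.one_rpow, one_mul, Real.mul_rpow (by positivity) (by positivity),
    Real.div_rpow hy hN.le, ← Real.exp_mul] at h
  have hN' : 0 < N ^ t := Real.rpow_pos_of_pos hN t
  have h2 := mul_le_mul_of_nonneg_left h (mul_pos hN' (Real.exp_pos (t * b))).le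
  have e1 : N ^ t * Real.exp (t * b) * (y ^ t / N ^ t * Real.exp (-b * t)) = y ^ t := by
    have : Real.exp (t * b) * Real.exp (-b * t) = 1 := by
      rw [← Real.exp_add, ← Real.exp_zero]; congr 1; ring
    calc _ = (N ^ t / N ^ t) * y ^ t * (Real.exp (t * b) * Real.exp (-b * t)) := by ring
      _ = _ := by rw [this, div_self hN'.ne']; ring
  rw [e1] at h2
  refine h2.trans_eq ?_
  rw [show (t - 1) * b = t * b + -b by ring, Real.exp_add]
  ring

/-- If some exponent is nonnegative, each inner sum containing it is at least 1, hence so is the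
nested sum of powers. Tangents are then taken at N exp ψ for the inner power and at B N^lam exp φ
for the outer one. Taking logarithms of partial expectations for ψ and φ makes all resulting terms
have the same mean. -/
theorem one_le_tangent {ι κ : Type*} (s : Finset ι) (J : ι → Finset κ) {B N lam rho : ℝ}
    (hB : 0 < B) (hN : 0 < N) (hl0 : 0 ≤ lam) (hl1 : lam ≤ 1) (hr0 : 0 ≤ rho) (hr1 : rho ≤ 1)
    (φ : ℝ) (ψ : ι → ℝ) (e : κ → ℝ) {U₀ : ι} {j₀ : κ} (hU₀ : U₀ ∈ s) (hj₀ : j₀ ∈ J U₀)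
    (he : 0 ≤ e j₀) :
    1 ≤ B ^ rho * N ^ (rho * lam) * ((1 - rho) * Real.exp (rho * φ) + rho * B⁻¹ *
      ∑ U ∈ s, ((1 - lam) * Real.exp ((rho - 1) * φ + lam * ψ U) +
        lam * N⁻¹ * ∑ j ∈ J U, Real.exp ((rho - 1) * φ + (lam - 1) * ψ U + e j))) := by
  set Y : ι → ℝ := fun U => ∑ j ∈ J U, Real.exp (e j) with hY
  have hY0 (U) : 0 ≤ Y U := Finset.sum_nonneg fun _ _ => (Real.exp_pos _).le
  have hY1 : 1 ≤ Y U₀ := (Real.one_le_exp he).trans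
    (Finset.single_le_sum (f := fun j => Real.exp (e j)) (fun _ _ => (Real.exp_pos _).le) hj₀)
  set Z := ∑ U ∈ s, Y U ^ lam with hZ
  have hZ1 : 1 ≤ Z := (Real.one_le_rpow hY1 hl0).trans
    (Finset.single_le_sum (f := fun U => Y U ^ lam)
      (fun U _ => Real.rpow_nonneg (hY0 U) _) hU₀)
  have hNl : 0 < N ^ lam := Real.rpow_pos_of_pos hN lam
  have h := (Real.one_le_rpow hZ1 hr0).trans
    (rpow_le_tangent φ (zero_le_one.trans hZ1) (mul_pos hB hNl) hr0 hr1)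
  rw [Real.mul_rpow hB.le hNl.le, ← Real.rpow_mul hN.le, mul_comm lam rho] at h
  set T := ∑ U ∈ s, ((1 - lam) * Real.exp (lam * ψ U) +
      lam * N⁻¹ * (Real.exp ((lam - 1) * ψ U) * Y U)) with hT
  have hZ2 : Z ≤ N ^ lam * T := by
    rw [hT, Finset.mul_sum]
    exact Finset.sum_le_sum fun U _ => rpow_le_tangent (ψ U) (hY0 U) hN hl0 hl1
  have hT2 : Real.exp ((rho - 1) * φ) * T =
      ∑ U ∈ s, ((1 - lam) * Real.exp ((rho - 1) * φ + lam * ψ U) +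
        lam * N⁻¹ * ∑ j ∈ J U, Real.exp ((rho - 1) * φ + (lam - 1) * ψ U + e j)) := by
    rw [hT, Finset.mul_sum]
    refine Finset.sum_congr rfl fun U _ => ?_
    simp only [Real.exp_add, hY, ← Finset.mul_sum]
    ring
  rw [← hT2]
  refine h.trans (mul_le_mul_of_nonneg_left (add_le_add_right ?_ _)
    (mul_pos (Real.rpow_pos_of_pos hB _) (Real.rpow_pos_of_pos hN _)).le)
  have hZ3 : Real.exp ((rho - 1) * φ) * Z ≤ Real.exp ((rho - 1) * φ) * (N ^ lam * T) :=
    mul_le_mul_of_nonneg_left hZ2 (Real.exp_pos _).le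
  have hc : 0 ≤ rho * (B * N ^ lam)⁻¹ := mul_nonneg hr0 (inv_pos.2 (mul_pos hB hNl)).le
  refine (mul_le_mul_of_nonneg_left hZ3 hc).trans_eq ?_
  rw [mul_inv]
  field_simp

end Tangent

/-! ### The three successive Gaussian averages for one coordinate. -/

section WeightEvent

/-- Logarithm of the likelihood weight of one coordinate: noise `z`, and, relative to the true
codeword `X` and the sections `U` in error, `x = αX`, `y = X_U - αX`, and the part `x'` of the
competing codeword that lies in `U`. -/
noncomputable def logWeight (z x y x' : ℝ) : ℝ := 1 / 2 * (z ^ 2 - (z + x + y - x') ^ 2)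

/-- Log-expectation of `logWeight` over `x'`; here `A = α snr`. -/
noncomputable def logPartial (A z x y : ℝ) : ℝ :=
  1 / 2 * (z ^ 2 - (z + x + y) ^ 2 / (1 + A)) - 1 / 2 * Real.log (1 + A)

/-- Log-expectation of `lam * logPartial` over `y`. -/
noncomputable def logTotal (lam A τ z x : ℝ) : ℝ :=
  lam / 2 * (z ^ 2 - (z + x) ^ 2 / τ) - lam / 2 * Real.log (1 + A) - 1 / 2 * Real.log (τ / (1 + A))

/-- The parameter `τ = 1 + α snr + lam α (1 - α) snr`. -/
noncomputable def tiltVar (S α lam : ℝ) : ℝ := 1 + α * S + lam * (α * (1 - α) * S)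

/-- Exponent per coordinate of the `rho`-th moment of the union-type sum. -/
noncomputable def rowExponent (S α lam rho : ℝ) : ℝ :=
  rho * lam / 2 * Real.log (1 + α * S) + rho / 2 * Real.log (tiltVar S α lam / (1 + α * S)) +
    1 / 2 * Real.log (1 + rho * lam / tiltVar S α lam * (α ^ 2 * S)) +
    1 / 2 * Real.log (1 - rho * lam +
      rho * lam / (tiltVar S α lam + rho * lam * (α ^ 2 * S)))

theorem one_le_tiltVar {S α lam : ℝ} (hS : 0 ≤ S) (hα0 : 0 ≤ α) (hα1 : α ≤ 1) (hl : 0 ≤ lam) :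
    1 ≤ tiltVar S α lam := by
  have := sub_nonneg.2 hα1
  have : 0 ≤ α * S + lam * (α * (1 - α) * S) := by positivity
  rw [tiltVar]; linarith

variable {S α lam rho : ℝ}

theorem lintegral_logWeight (hS : 0 ≤ S) (hα0 : 0 ≤ α) (a z x y : ℝ) :
    ∫⁻ x', ENNReal.ofReal (Real.exp (a + (lam - 1) * logPartial (α * S) z x y +
        logWeight z x y x')) ∂(gaussianReal 0 (Real.toNNReal (α * S))) =
      ENNReal.ofReal (Real.exp (a + lam * logPartial (α * S) z x y)) := by
  have hA : 0 ≤ α * S := mul_nonneg hα0 hS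
  have h := lintegral_exp_sq_gaussian (Real.toNNReal (α * S)) 1 (-(z + x + y))
    (a + (lam - 1) * logPartial (α * S) z x y + 1 / 2 * z ^ 2)
    (by rw [Real.coe_toNNReal _ hA]; positivity)
  rw [Real.coe_toNNReal _ hA] at h
  convert h using 2
  · ext x'
    rw [logWeight]; ring_nf
  · rw [logPartial]; ring_nf

theorem lintegral_logPartial (hS : 0 ≤ S) (hα0 : 0 ≤ α) (hα1 : α ≤ 1) (hl : 0 ≤ lam) (z x : ℝ) :
    ∫⁻ y, ENNReal.ofReal (Real.exp ((rho - 1) * logTotal lam (α * S) (tiltVar S α lam) z x +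
        lam * logPartial (α * S) z x y)) ∂(gaussianReal 0 (Real.toNNReal (α * (1 - α) * S))) =
      ENNReal.ofReal (Real.exp (rho * logTotal lam (α * S) (tiltVar S α lam) z x)) := by
  have h1α := sub_nonneg.2 hα1
  have hA : 0 ≤ α * S := mul_nonneg hα0 hS
  have hB : 0 ≤ α * (1 - α) * S := by positivity
  have hτ : 1 + lam / (1 + α * S) * (α * (1 - α) * S) = tiltVar S α lam / (1 + α * S) := by
    rw [tiltVar]; field_simp
  have h := lintegral_exp_sq_gaussian (Real.toNNReal (α * (1 - α) * S)) (lam / (1 + α * S)) (z + x)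
    ((rho - 1) * logTotal lam (α * S) (tiltVar S α lam) z x + lam / 2 * z ^ 2 -
      lam / 2 * Real.log (1 + α * S))
    (by rw [Real.coe_toNNReal _ hB]; positivity)
  rw [Real.coe_toNNReal _ hB, hτ] at h
  have hτ0 : 0 < tiltVar S α lam := zero_lt_one.trans_le (one_le_tiltVar hS hα0 hα1 hl)
  convert h using 2
  · ext y
    rw [logPartial]; congr 2; field_simp; ring
  · congr 1
    have : lam / (1 + α * S) / 2 * (z + x) ^ 2 / (tiltVar S α lam / (1 + α * S)) =
        lam / 2 * ((z + x) ^ 2 / tiltVar S α lam) := by field_simp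
    rw [this, logTotal]; ring

theorem lintegral_logTotal (hS : 0 ≤ S) (hα0 : 0 ≤ α) (hα1 : α ≤ 1) (hl0 : 0 ≤ lam)
    (hl1 : lam ≤ 1) (hr0 : 0 ≤ rho) (hr1 : rho ≤ 1) :
    ∫⁻ z, ∫⁻ x, ENNReal.ofReal (Real.exp (rho * logTotal lam (α * S) (tiltVar S α lam) z x))
        ∂(gaussianReal 0 (Real.toNNReal (α ^ 2 * S))) ∂(gaussianReal 0 1) =
      ENNReal.ofReal (Real.exp (-rowExponent S α lam rho)) := by
  have hτ0 : 0 < tiltVar S α lam := zero_lt_one.trans_le (one_le_tiltVar hS hα0 hα1 hl0)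
  have hB : 0 ≤ α ^ 2 * S := by positivity
  have hμ0 : 0 ≤ rho * lam := mul_nonneg hr0 hl0
  have hμ1 : rho * lam ≤ 1 := mul_le_one₀ hr1 hl0 hl1
  rw [rowExponent]
  generalize tiltVar S α lam = τ at hτ0
  have hpos : 0 < 1 + rho * lam / τ * (α ^ 2 * S) := by positivity
  have hfrac : 0 < 1 - rho * lam + rho * lam / (τ + rho * lam * (α ^ 2 * S)) := by
    have h1 : 0 < τ + rho * lam * (α ^ 2 * S) := by positivity
    rcases hμ0.eq_or_lt with h | h
    · rw [← h]; norm_num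
    · have := div_pos h h1
      linarith
  have hin (z : ℝ) : ∫⁻ x, ENNReal.ofReal (Real.exp (rho * logTotal lam (α * S) τ z x))
        ∂(gaussianReal 0 (Real.toNNReal (α ^ 2 * S))) =
      ENNReal.ofReal (Real.exp ((-(rho * lam / 2 * Real.log (1 + α * S)) -
        rho / 2 * Real.log (τ / (1 + α * S)) -
        1 / 2 * Real.log (1 + rho * lam / τ * (α ^ 2 * S))) -
        (-(rho * lam) + rho * lam / (τ + rho * lam * (α ^ 2 * S))) / 2 * (0 + z) ^ 2)) := by
    have h := lintegral_exp_sq_gaussian (Real.toNNReal (α ^ 2 * S)) (rho * lam / τ) z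
      (rho * lam / 2 * z ^ 2 - rho * lam / 2 * Real.log (1 + α * S) -
        rho / 2 * Real.log (τ / (1 + α * S)))
      (by rw [Real.coe_toNNReal _ hB]; exact hpos)
    rw [Real.coe_toNNReal _ hB] at h
    convert h using 2
    · ext x
      rw [logTotal]; congr 2; ring
    · congr 1
      have h3 : rho * lam / τ / 2 * z ^ 2 / (1 + rho * lam / τ * (α ^ 2 * S)) =
          rho * lam / (τ + rho * lam * (α ^ 2 * S)) / 2 * z ^ 2 := by
        have : τ + rho * lam * (α ^ 2 * S) ≠ 0 := by positivity
        rw [show 1 + rho * lam / τ * (α ^ 2 * S) = (τ + rho * lam * (α ^ 2 * S)) / τ by field_simp]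
        field_simp
      rw [h3]; ring
  simp only [hin]
  rw [lintegral_exp_sq_gaussian _ _ _ _ (by push_cast; linarith)]
  congr 2
  push_cast
  rw [show 1 + (-(rho * lam) + rho * lam / (τ + rho * lam * (α ^ 2 * S))) * 1 =
    1 - rho * lam + rho * lam / (τ + rho * lam * (α ^ 2 * S)) by ring]
  ring

/-- Dividing by σ makes the noise standard and gives the full codeword variance S = snr per
coordinate; rows are i.i.d., hence the n-th power. -/
theorem lintegral_channel_row {n L M : ℕ} (hn : 1 ≤ n) (hL : 0 < L) {P σ : ℝ} (hP : 0 < P)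
    (hσ : 0 < σ) (m m' : Fin L → Fin M) (U : Finset (Fin L)) (hU : ∀ l, m' l ≠ m l ↔ l ∈ U)
    (hα : α = U.card / L) (hS : S = P / σ ^ 2) {F : ℝ → ℝ → ℝ → ℝ → ℝ≥0∞}
    (hF : Measurable fun q : ℝ × ℝ × ℝ × ℝ => F q.1 q.2.1 q.2.2.1 q.2.2.2) :
    ∫⁻ p, ∏ i, F (p.2 i / σ) (α * (flatCoeff n L P / σ * ∑ l, p.1 i (l, m l)))
        (flatCoeff n L P / σ * ∑ l ∈ U, p.1 i (l, m l) -
          α * (flatCoeff n L P / σ * ∑ l, p.1 i (l, m l)))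
        (flatCoeff n L P / σ * ∑ l ∈ U, p.1 i (l, m' l))
        ∂((dictionaryLaw n L M).prod (noiseLaw n σ)) =
      (∫⁻ z, ∫⁻ x, ∫⁻ y, ∫⁻ x', F z x y x' ∂(gaussianReal 0 (Real.toNNReal (α * S)))
        ∂(gaussianReal 0 (Real.toNNReal (α * (1 - α) * S)))
        ∂(gaussianReal 0 (Real.toNNReal (α ^ 2 * S))) ∂(gaussianReal 0 1)) ^ n := by
  set b := flatCoeff n L P / σ with hb
  have hSb : S = ((n : ℝ≥0)⁻¹ : ℝ≥0) * (b ^ 2 * L) := by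
    have hn' : (n : ℝ) ≠ 0 := by positivity
    have hL' : (L : ℝ) ≠ 0 := by positivity
    rw [hb, flatCoeff, div_pow, Real.sq_sqrt (by positivity), hS]
    push_cast
    field_simp
  have hf : Measurable fun q : (Fin L × Fin M → ℝ) × ℝ =>
      F (q.2 / σ) (α * (b * ∑ l, q.1 (l, m l)))
        (b * ∑ l ∈ U, q.1 (l, m l) - α * (b * ∑ l, q.1 (l, m l)))
        (b * ∑ l ∈ U, q.1 (l, m' l)) :=
    hF.comp (g := fun q : ℝ × ℝ × ℝ × ℝ => F q.1 q.2.1 q.2.2.1 q.2.2.2)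
      (f := fun q : (Fin L × Fin M → ℝ) × ℝ => (q.2 / σ, α * (b * ∑ l, q.1 (l, m l)),
        b * ∑ l ∈ U, q.1 (l, m l) - α * (b * ∑ l, q.1 (l, m l)),
        b * ∑ l ∈ U, q.1 (l, m' l))) (by fun_prop)
  have h := lintegral_channel (n := n) σ hf
  refine h.trans ?_
  congr 1
  have hrow (z : ℝ) := lintegral_row hL (n : ℝ≥0)⁻¹ b S α m m' U hU hα hSb (F := F (z / σ))
    (hF.comp (f := fun q : ℝ × ℝ × ℝ => (z / σ, q)) (by fun_prop))
  simp only [hrow]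
  have hz : (gaussianReal 0 (Real.toNNReal (σ ^ 2))).map (fun z => z / σ) = gaussianReal 0 1 := by
    rw [gaussianReal_map_div_const]
    congr 1
    · simp
    · ext
      push_cast
      rw [Real.coe_toNNReal _ (by positivity)]
      simp [hσ.ne']
  rw [← hz, lintegral_map (f := fun z => ∫⁻ x, ∫⁻ y, ∫⁻ x', F z x y x'
    ∂(gaussianReal 0 (Real.toNNReal (α * S)))
        ∂(gaussianReal 0 (Real.toNNReal (α * (1 - α) * S)))
        ∂(gaussianReal 0 (Real.toNNReal (α ^ 2 * S)))) _ (by fun_prop)]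
  refine Measurable.lintegral_prod_right (f := fun z x => ∫⁻ y, ∫⁻ x', F z x y x'
    ∂(gaussianReal 0 (Real.toNNReal (α * S)))
        ∂(gaussianReal 0 (Real.toNNReal (α * (1 - α) * S)))) ?_
  refine Measurable.lintegral_prod_right (f := fun (q : ℝ × ℝ) y => ∫⁻ x', F q.1 q.2 y x'
    ∂(gaussianReal 0 (Real.toNNReal (α * S)))) ?_
  refine Measurable.lintegral_prod_right (f := fun (q : (ℝ × ℝ) × ℝ) x' => F q.1.1 q.1.2 q.2 x') ?_
  exact hF.comp (f := fun q : ((ℝ × ℝ) × ℝ) × ℝ => (q.1.1.1, q.1.1.2, q.1.2, q.2)) (by fun_prop)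

end WeightEvent

/-! ### The Gallager-type union bound. -/

section UnionBound

/-- The messages that differ from `m` exactly on the sections in `U`. -/
def messagesOff {L M : ℕ} (m : Fin L → Fin M) (U : Finset (Fin L)) : Finset (Fin L → Fin M) :=
  {m' | ∀ l, m' l ≠ m l ↔ l ∈ U}

theorem card_messagesOff_le {L M : ℕ} (m : Fin L → Fin M) (U : Finset (Fin L)) :
    (messagesOff m U).card ≤ M ^ U.card := by
  have hsub : messagesOff m U ⊆ Fintype.piFinset fun l => if l ∈ U then Finset.univ else {m l} := by
    intro m' hm'
    rw [messagesOff, Finset.mem_filter] at hm'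
    rw [Fintype.mem_piFinset]
    intro l
    split_ifs with h
    · exact Finset.mem_univ _
    · by_contra hne
      exact h ((hm'.2 l).1 (by simpa using hne))
  refine (Finset.card_le_card hsub).trans_eq ?_
  rw [Fintype.card_piFinset]
  simp only [apply_ite Finset.card, Finset.card_univ, Fintype.card_fin, Finset.card_singleton,
    Finset.prod_ite_mem, Finset.univ_inter, Finset.prod_const]

/-- Sections outside U cancel between the two codewords, and x + y = X_U whatever α is. -/
theorem sum_logWeight {n L M : ℕ} {σ : ℝ} (hσ : 0 < σ) (c α : ℝ)
    (A : Fin n → Fin L × Fin M → ℝ) (z : Fin n → ℝ) (m m' : Fin L → Fin M)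
    (U : Finset (Fin L)) (hU : m' ∈ messagesOff m U) :
    ∑ i, logWeight (z i / σ) (α * (c / σ * ∑ l, A i (l, m l)))
        (c / σ * ∑ l ∈ U, A i (l, m l) - α * (c / σ * ∑ l, A i (l, m l)))
        (c / σ * ∑ l ∈ U, A i (l, m' l)) =
      (sqDist A (codeword A (messageVector c m) + z) (messageVector c m) -
        sqDist A (codeword A (messageVector c m) + z) (messageVector c m')) / (2 * σ ^ 2) := by
  have hU' : ∀ l, m' l ≠ m l ↔ l ∈ U := by simpa [messagesOff] using hU
  rw [sqDist, sqDist, ← Finset.sum_sub_distrib, Finset.sum_div]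
  refine Finset.sum_congr rfl fun i _ => ?_
  have hd : (∑ l, A i (l, m l)) - ∑ l, A i (l, m' l) =
      ∑ l ∈ U, A i (l, m l) - ∑ l ∈ U, A i (l, m' l) := by
    rw [← Finset.sum_sub_distrib, ← Finset.sum_sub_distrib]
    refine (Finset.sum_subset (Finset.subset_univ U) fun l _ hl => ?_).symm
    rw [not_ne_iff.1 fun h => hl ((hU' l).1 h), sub_self]
  have hd' : ∑ l, A i (l, m l) = ∑ l, A i (l, m' l) +
      (∑ l ∈ U, A i (l, m l) - ∑ l ∈ U, A i (l, m' l)) := by linarith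
  rw [logWeight, Pi.add_apply, codeword_messageVector, codeword_messageVector, hd']
  field_simp
  ring

/-- Union bound of Gallager type in abstract form. -/
theorem measure_exists_nonneg_le {Ω ι κ : Type*} [MeasurableSpace Ω] (ν : Measure Ω)
    (s : Finset ι) (J : ι → Finset κ) {B N lam rho : ℝ} (hB : 0 < B) (hN : 0 < N)
    (hl0 : 0 ≤ lam) (hl1 : lam ≤ 1) (hr0 : 0 ≤ rho) (hr1 : rho ≤ 1)
    (hs : (s.card : ℝ) ≤ B) (hJ : ∀ U ∈ s, ((J U).card : ℝ) ≤ N)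
    {φ : Ω → ℝ} {ψ : ι → Ω → ℝ} {e : κ → Ω → ℝ} (hφ : Measurable φ)
    (hψ : ∀ U, Measurable (ψ U)) (he : ∀ j, Measurable (e j)) {I : ℝ≥0∞}
    (h₁ : ∫⁻ p, ENNReal.ofReal (Real.exp (rho * φ p)) ∂ν ≤ I)
    (h₂ : ∀ U ∈ s, ∫⁻ p, ENNReal.ofReal (Real.exp ((rho - 1) * φ p + lam * ψ U p)) ∂ν ≤ I)
    (h₃ : ∀ U ∈ s, ∀ j ∈ J U, ∫⁻ p, ENNReal.ofReal (Real.exp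
      ((rho - 1) * φ p + (lam - 1) * ψ U p + e j p)) ∂ν ≤ I) :
    ν {p | ∃ U ∈ s, ∃ j ∈ J U, 0 ≤ e j p} ≤ ENNReal.ofReal (B ^ rho * N ^ (rho * lam)) * I := by
  let f₁ : Ω → ℝ≥0∞ := fun p => ENNReal.ofReal (Real.exp (rho * φ p))
  let f₂ : ι → Ω → ℝ≥0∞ := fun U p =>
    ENNReal.ofReal (Real.exp ((rho - 1) * φ p + lam * ψ U p))
  let f₃ : ι → κ → Ω → ℝ≥0∞ := fun U j p =>
    ENNReal.ofReal (Real.exp ((rho - 1) * φ p + (lam - 1) * ψ U p + e j p))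
  have hf₁ : Measurable f₁ := by fun_prop
  have hf₂ (U) : Measurable (f₂ U) := by fun_prop
  have hf₃ (U j) : Measurable (f₃ U j) := by fun_prop
  have hr1' := sub_nonneg.2 hr1
  have hl1' := sub_nonneg.2 hl1
  have hK : 0 ≤ B ^ rho * N ^ (rho * lam) := by positivity
  -- Markov's inequality is applied to this majorant. The weights 1 - rho and rho, and 1 - lam and
  -- lam, each sum to 1 once the cardinality bounds B and N are used, so its mean is at most the
  -- prefactor times I.
  let g : Ω → ℝ≥0∞ := fun p => ENNReal.ofReal (B ^ rho * N ^ (rho * lam)) *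
    (ENNReal.ofReal (1 - rho) * f₁ p + ENNReal.ofReal (rho * B⁻¹) *
      ∑ U ∈ s, (ENNReal.ofReal (1 - lam) * f₂ U p +
        ENNReal.ofReal (lam * N⁻¹) * ∑ j ∈ J U, f₃ U j p))
  have hg1 : {p | ∃ U ∈ s, ∃ j ∈ J U, 0 ≤ e j p} ⊆ {p | 1 ≤ g p} := by
    rintro p ⟨U₀, hU₀, j₀, hj₀, hp⟩
    have h := one_le_tangent s J hB hN hl0 hl1 hr0 hr1 (φ p) (fun U => ψ U p) (fun j => e j p)
      hU₀ hj₀ hp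
    have h' := ENNReal.ofReal_le_ofReal h
    rw [ENNReal.ofReal_one] at h'
    refine h'.trans_eq ?_
    have hin (U : ι) : 0 ≤ (1 - lam) * Real.exp ((rho - 1) * φ p + lam * ψ U p) +
        lam * N⁻¹ * ∑ j ∈ J U, Real.exp ((rho - 1) * φ p + (lam - 1) * ψ U p + e j p) := by
      positivity
    rw [ENNReal.ofReal_mul hK, ENNReal.ofReal_add (by positivity)
      (mul_nonneg (by positivity) (Finset.sum_nonneg fun U _ => hin U)),
      ENNReal.ofReal_mul hr1', ENNReal.ofReal_mul (p := rho * B⁻¹) (by positivity),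
      ENNReal.ofReal_sum_of_nonneg fun U _ => hin U]
    congr 3
    refine Finset.sum_congr rfl fun U _ => ?_
    rw [ENNReal.ofReal_add (by positivity) (by positivity), ENNReal.ofReal_mul hl1',
      ENNReal.ofReal_mul (by positivity), ENNReal.ofReal_sum_of_nonneg fun _ _ => by positivity]
  have hg2 : ∫⁻ p, g p ∂ν ≤ ENNReal.ofReal (B ^ rho * N ^ (rho * lam)) * I := by
    have e1 : ∫⁻ p, g p ∂ν = ENNReal.ofReal (B ^ rho * N ^ (rho * lam)) *
        (ENNReal.ofReal (1 - rho) * ∫⁻ p, f₁ p ∂ν + ENNReal.ofReal (rho * B⁻¹) *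
        ∑ U ∈ s, (ENNReal.ofReal (1 - lam) * ∫⁻ p, f₂ U p ∂ν +
        ENNReal.ofReal (lam * N⁻¹) * ∑ j ∈ J U, ∫⁻ p, f₃ U j p ∂ν)) := by
      rw [lintegral_const_mul _ (by fun_prop), lintegral_add_left (by fun_prop),
        lintegral_const_mul _ hf₁, lintegral_const_mul _ (by fun_prop),
        lintegral_finsetSum _ fun U _ => by fun_prop]
      congr 3
      refine Finset.sum_congr rfl fun U _ => ?_
      rw [lintegral_add_left (by fun_prop), lintegral_const_mul _ (hf₂ U),
        lintegral_const_mul _ (by fun_prop), lintegral_finsetSum _ fun j _ => hf₃ U j]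
    have hNc {U : ι} (hU : U ∈ s) : ENNReal.ofReal (lam * N⁻¹) * ∑ j ∈ J U, ∫⁻ p, f₃ U j p ∂ν ≤
        ENNReal.ofReal lam * I := by
      calc _ ≤ ENNReal.ofReal (lam * N⁻¹) * ∑ _j ∈ J U, I := by
            gcongr with j hj; exact h₃ U hU j hj
        _ = ENNReal.ofReal (lam * N⁻¹ * (J U).card) * I := by
            rw [Finset.sum_const, nsmul_eq_mul, ENNReal.ofReal_mul (p := lam * N⁻¹) (by positivity),
              ENNReal.ofReal_natCast, mul_assoc]
        _ ≤ _ := by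
            gcongr
            calc lam * N⁻¹ * (J U).card ≤ lam * N⁻¹ * N := by gcongr; exact hJ U hU
              _ = lam := by field_simp
    have hlI : ENNReal.ofReal (1 - lam) * I + ENNReal.ofReal lam * I = I := by
      rw [← add_mul, ← ENNReal.ofReal_add hl1' hl0]; simp
    have hrI : ENNReal.ofReal (1 - rho) * I + ENNReal.ofReal rho * I = I := by
      rw [← add_mul, ← ENNReal.ofReal_add hr1' hr0]; simp
    rw [e1]
    gcongr
    refine le_trans (add_le_add (mul_le_mul_right h₁ _) ?_) hrI.le
    calc _ ≤ ENNReal.ofReal (rho * B⁻¹) * ∑ _U ∈ s, I := by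
          gcongr with U hU
          exact (add_le_add (mul_le_mul_right (h₂ U hU) _) (hNc hU)).trans hlI.le
      _ = ENNReal.ofReal (rho * B⁻¹ * s.card) * I := by
          rw [Finset.sum_const, nsmul_eq_mul, ENNReal.ofReal_mul (p := rho * B⁻¹) (by positivity),
            ENNReal.ofReal_natCast, mul_assoc]
      _ ≤ _ := by
          gcongr
          calc rho * B⁻¹ * s.card ≤ rho * B⁻¹ * B := by gcongr
            _ = rho := by field_simp
  calc ν _ ≤ ν {p | 1 ≤ g p} := measure_mono hg1
    _ = 1 * ν {p | 1 ≤ g p} := (one_mul _).symm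
    _ ≤ ∫⁻ p, g p ∂ν := mul_meas_ge_le_lintegral (by fun_prop) 1
    _ ≤ _ := hg2

theorem lintegral_exp_sum {n L M k : ℕ} (hn : 1 ≤ n) (hL : 0 < L)
    {P σ S α : ℝ} (hP : 0 < P) (hσ : 0 < σ) (hS : S = P / σ ^ 2) (hα : α = k / L)
    {m m' : Fin L → Fin M} {U : Finset (Fin L)} (hUk : U.card = k) (hm' : m' ∈ messagesOff m U)
    {F : ℝ → ℝ → ℝ → ℝ → ℝ} {I : ℝ}
    (hF : Measurable fun q : ℝ × ℝ × ℝ × ℝ => F q.1 q.2.1 q.2.2.1 q.2.2.2)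
    (hFI : ∫⁻ z, ∫⁻ x, ∫⁻ y, ∫⁻ x', ENNReal.ofReal (Real.exp (F z x y x'))
        ∂(gaussianReal 0 (Real.toNNReal (α * S)))
        ∂(gaussianReal 0 (Real.toNNReal (α * (1 - α) * S)))
        ∂(gaussianReal 0 (Real.toNNReal (α ^ 2 * S))) ∂(gaussianReal 0 1) =
        ENNReal.ofReal (Real.exp I)) :
    ∫⁻ p, ENNReal.ofReal (Real.exp (∑ i, F (p.2 i / σ)
        (α * (flatCoeff n L P / σ * ∑ l, p.1 i (l, m l)))
        (flatCoeff n L P / σ * ∑ l ∈ U, p.1 i (l, m l) -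
          α * (flatCoeff n L P / σ * ∑ l, p.1 i (l, m l)))
        (flatCoeff n L P / σ * ∑ l ∈ U, p.1 i (l, m' l))))
        ∂((dictionaryLaw n L M).prod (noiseLaw n σ)) = ENNReal.ofReal (Real.exp (n * I)) := by
  have hU : ∀ l, m' l ≠ m l ↔ l ∈ U := by simpa [messagesOff] using hm'
  have h := lintegral_channel_row (α := α) hn hL hP hσ m m' U hU (by rw [hα, hUk]) hS
    (F := fun z x y x' => ENNReal.ofReal (Real.exp (F z x y x'))) (by fun_prop)
  rw [hFI, ← ENNReal.ofReal_pow (Real.exp_pos _).le, ← Real.exp_nat_mul] at h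
  rw [← h]
  refine lintegral_congr fun p => ?_
  rw [Real.exp_sum, ENNReal.ofReal_prod_of_nonneg fun i _ => (Real.exp_pos _).le]

/-- Probability that some message differing from the true one in exactly `k` sections is at least
as likely: a Gallager-type bound with parameters `lam` and `rho`. -/
theorem weight_event_le {n L M k : ℕ} (hn : 1 ≤ n) (hL : 0 < L) (hM : 2 ≤ M) (hk : k ≤ L)
    {P σ S α lam rho : ℝ} (hP : 0 < P) (hσ : 0 < σ) (hS : S = P / σ ^ 2) (hα : α = k / L)
    (hl0 : 0 ≤ lam) (hl1 : lam ≤ 1) (hr0 : 0 ≤ rho) (hr1 : rho ≤ 1) (m : Fin L → Fin M) :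
    ((dictionaryLaw n L M).prod (noiseLaw n σ))
      {p | ∃ m' : Fin L → Fin M, (Finset.univ.filter fun l => m' l ≠ m l).card = k ∧
        sqDist p.1 (codeword p.1 (messageVector (flatCoeff n L P) m) + p.2)
            (messageVector (flatCoeff n L P) m') ≤
          sqDist p.1 (codeword p.1 (messageVector (flatCoeff n L P) m) + p.2)
            (messageVector (flatCoeff n L P) m)} ≤
      ENNReal.ofReal ((L.choose k : ℝ) ^ rho * ((M : ℝ) ^ k) ^ (rho * lam) *
        Real.exp (n * -rowExponent S α lam rho)) := by
  classical
  have hS0 : 0 ≤ S := by rw [hS]; positivity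
  have hL' : (0 : ℝ) < L := by exact_mod_cast hL
  have hα0 : 0 ≤ α := by rw [hα]; positivity
  have hα1 : α ≤ 1 := by rw [hα, div_le_one hL']; exact_mod_cast hk
  have hB : (0 : ℝ) < L.choose k := by exact_mod_cast Nat.choose_pos hk
  have hN : (0 : ℝ) < (M : ℝ) ^ k := by positivity
  -- The integration formula is stated for a pair (U, m'); a dummy competitor allows its use for
  -- integrands that involve no competitor. Its existence needs M ≥ 2.
  have hoff (U : Finset (Fin L)) : ∃ m', m' ∈ messagesOff m U := by
    have : Nontrivial (Fin M) := Fin.nontrivial_iff_two_le.2 hM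
    choose f hf using fun l => exists_ne (m l)
    refine ⟨fun l => if l ∈ U then f l else m l, ?_⟩
    simp only [messagesOff, Finset.mem_filter, Finset.mem_univ, true_and]
    intro l
    by_cases hl : l ∈ U <;> simp [hl, hf l]
  let c := flatCoeff n L P
  let Φ : ℝ → ℝ → ℝ := logTotal lam (α * S) (tiltVar S α lam)
  let Ψ : ℝ → ℝ → ℝ → ℝ := logPartial (α * S)
  have hΦm : Measurable fun q : ℝ × ℝ => Φ q.1 q.2 := by
    simp only [Φ, logTotal]; fun_prop
  have hΨm : Measurable fun q : ℝ × ℝ × ℝ => Ψ q.1 q.2.1 q.2.2 := by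
    simp only [Ψ, logPartial]; fun_prop
  have hEm : Measurable fun q : ℝ × ℝ × ℝ × ℝ => logWeight q.1 q.2.1 q.2.2.1 q.2.2.2 := by
    simp only [logWeight]; fun_prop
  have hΦ4 : Measurable fun q : ℝ × ℝ × ℝ × ℝ => Φ q.1 q.2.1 :=
    hΦm.comp (f := fun q : ℝ × ℝ × ℝ × ℝ => (q.1, q.2.1)) (by fun_prop)
  have hΨ4 : Measurable fun q : ℝ × ℝ × ℝ × ℝ => Ψ q.1 q.2.1 q.2.2.1 :=
    hΨm.comp (f := fun q : ℝ × ℝ × ℝ × ℝ => (q.1, q.2.1, q.2.2.1)) (by fun_prop)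
  have hI := lintegral_logTotal hS0 hα0 hα1 hl0 hl1 hr0 hr1
  let φ : (Fin n → Fin L × Fin M → ℝ) × (Fin n → ℝ) → ℝ := fun p =>
    ∑ i, Φ (p.2 i / σ) (α * (c / σ * ∑ l, p.1 i (l, m l)))
  let ψ : Finset (Fin L) → (Fin n → Fin L × Fin M → ℝ) × (Fin n → ℝ) → ℝ := fun U p =>
    ∑ i, Ψ (p.2 i / σ) (α * (c / σ * ∑ l, p.1 i (l, m l)))
      (c / σ * ∑ l ∈ U, p.1 i (l, m l) - α * (c / σ * ∑ l, p.1 i (l, m l)))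
  let e : (Fin L → Fin M) → (Fin n → Fin L × Fin M → ℝ) × (Fin n → ℝ) → ℝ := fun m' p =>
    (sqDist p.1 (codeword p.1 (messageVector c m) + p.2) (messageVector c m) -
      sqDist p.1 (codeword p.1 (messageVector c m) + p.2) (messageVector c m')) / (2 * σ ^ 2)
  have hφm : Measurable φ := Finset.measurable_fun_sum _ fun i _ =>
    hΦm.comp (f := fun p : (Fin n → Fin L × Fin M → ℝ) × (Fin n → ℝ) =>
      (p.2 i / σ, α * (c / σ * ∑ l, p.1 i (l, m l)))) (by fun_prop)
  have hψm (U) : Measurable (ψ U) := Finset.measurable_fun_sum _ fun i _ =>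
    hΨm.comp (f := fun p : (Fin n → Fin L × Fin M → ℝ) × (Fin n → ℝ) =>
      (p.2 i / σ, α * (c / σ * ∑ l, p.1 i (l, m l)),
        c / σ * ∑ l ∈ U, p.1 i (l, m l) - α * (c / σ * ∑ l, p.1 i (l, m l)))) (by fun_prop)
  have hem (m') : Measurable (e m') := by
    simp only [e, sqDist, codeword_messageVector, Pi.add_apply]; fun_prop
  have hmain := measure_exists_nonneg_le ((dictionaryLaw n L M).prod (noiseLaw n σ))
    (Finset.powersetCard k Finset.univ) (messagesOff m) hB hN hl0 hl1 hr0 hr1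
    (by simp) (fun U hU => by
      rw [← (Finset.mem_powersetCard.1 hU).2]; exact_mod_cast card_messagesOff_le m U)
    hφm hψm hem (I := ENNReal.ofReal (Real.exp (n * -rowExponent S α lam rho))) ?_ ?_ ?_
  · rw [ENNReal.ofReal_mul (by positivity)]
    refine le_trans (measure_mono ?_) hmain
    rintro p ⟨m', hcard, hle⟩
    refine ⟨Finset.univ.filter fun l => m' l ≠ m l, by simp [hcard], m',
      by simp [messagesOff], ?_⟩
    exact div_nonneg (sub_nonneg.2 hle) (by positivity)
  · obtain ⟨U, -, hUk⟩ := Finset.exists_subset_card_eq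
      (s := (Finset.univ : Finset (Fin L))) (n := k) (by simpa using hk)
    obtain ⟨m', hm'⟩ := hoff U
    refine Eq.le ?_
    rw [← lintegral_exp_sum hn hL hP hσ hS hα hUk hm' (F := fun z x _ _ => rho * Φ z x)
      (by fun_prop) (by simpa only [lintegral_const, measure_univ, mul_one] using hI)]
    simp only [φ, Finset.mul_sum]
    rfl
  · intro U hU
    obtain ⟨m', hm'⟩ := hoff U
    refine Eq.le ?_
    rw [← lintegral_exp_sum hn hL hP hσ hS hα (Finset.mem_powersetCard.1 hU).2 hm'
      (F := fun z x y _ => (rho - 1) * Φ z x + lam * Ψ z x y) (by fun_prop)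
      (by simpa only [Φ, Ψ, lintegral_const, measure_univ, mul_one,
        lintegral_logPartial hS0 hα0 hα1 hl0] using hI)]
    simp only [φ, ψ, Finset.mul_sum, Finset.sum_add_distrib]
    rfl
  · intro U hU m' hm'
    refine Eq.le ?_
    rw [← lintegral_exp_sum hn hL hP hσ hS hα (Finset.mem_powersetCard.1 hU).2 hm'
      (F := fun z x y x' => (rho - 1) * Φ z x + (lam - 1) * Ψ z x y + logWeight z x y x')
      (by fun_prop)
      (by simpa only [Φ, Ψ, lintegral_logWeight hS0 hα0, lintegral_logPartial hS0 hα0 hα1 hl0]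
        using hI)]
    refine lintegral_congr fun p => ?_
    rw [Finset.sum_add_distrib, sum_logWeight hσ _ _ _ _ _ _ _ hm', Finset.sum_add_distrib,
      ← Finset.mul_sum, ← Finset.mul_sum]

end UnionBound

/-! ### Lower bounds for the exponent of one coordinate. -/

section Exponent

variable {S α lam rho : ℝ}

/-- Determinant form of the last two terms of `rowExponent`. -/
theorem rowExponent_eq (hS : 0 ≤ S) (hα0 : 0 ≤ α) (hα1 : α ≤ 1) (hl0 : 0 ≤ lam) (hl1 : lam ≤ 1)
    (hr0 : 0 ≤ rho) (hr1 : rho ≤ 1) :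
    1 / tiltVar S α lam ≤ 1 - rho * lam +
        rho * lam * (1 + α ^ 2 * S * (1 - rho * lam)) / tiltVar S α lam ∧
      rowExponent S α lam rho = rho * lam / 2 * Real.log (1 + α * S) +
        rho / 2 * Real.log (tiltVar S α lam / (1 + α * S)) +
        1 / 2 * Real.log (1 - rho * lam +
          rho * lam * (1 + α ^ 2 * S * (1 - rho * lam)) / tiltVar S α lam) := by
  have hτ1 := one_le_tiltVar hS hα0 hα1 hl0
  rw [rowExponent]
  generalize tiltVar S α lam = τ at hτ1
  have hτ0 : 0 < τ := by linarith
  have hμ0 : 0 ≤ rho * lam := mul_nonneg hr0 hl0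
  have hμ1 : rho * lam ≤ 1 := mul_le_one₀ hr1 hl0 hl1
  generalize hμ : rho * lam = μ at hμ0 hμ1 ⊢
  have hμ1' := sub_nonneg.2 hμ1
  have hA : 0 ≤ α ^ 2 * S := by positivity
  generalize α ^ 2 * S = A at hA
  -- Besides positivity inside the logarithm, this bound controls the relative size of the
  -- correction in `rowExponent_ge`.
  have h1 : 1 / τ ≤ 1 - μ + μ * (1 + A * (1 - μ)) / τ := by
    rw [div_le_iff₀ hτ0, add_mul, div_mul_cancel₀ _ hτ0.ne']
    have := mul_nonneg hμ1' (sub_nonneg.2 hτ1)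
    have := mul_nonneg (mul_nonneg hμ0 hA) hμ1'
    nlinarith
  have hdet : (1 + μ / τ * A) * (1 - μ + μ / (τ + μ * A)) =
      1 - μ + μ * (1 + A * (1 - μ)) / τ := by
    have : τ + μ * A ≠ 0 := by positivity
    field_simp
    ring
  have hp : 0 < 1 + μ / τ * A := by positivity
  have hd : 0 < 1 - μ + μ * (1 + A * (1 - μ)) / τ := (one_div_pos.2 hτ0).trans_le h1
  have hq : 1 - μ + μ / (τ + μ * A) ≠ 0 := by
    intro h0
    rw [h0, mul_zero] at hdet
    exact hd.ne hdet
  refine ⟨h1, ?_⟩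
  rw [← hdet, Real.log_mul hp.ne' hq]
  ring

theorem neg_le_log_one_sub {u v : ℝ} (hv : v < 1) (h : v ≤ u * (1 - v)) :
    -u ≤ Real.log (1 - v) := by
  have h1 : 0 < 1 - v := by linarith
  have h2 := Real.one_sub_inv_le_log_of_pos h1
  have h3 : (1 - v)⁻¹ ≤ 1 + u := by
    rw [inv_le_iff_one_le_mul₀ h1]; nlinarith
  linarith

/-- At rho = 1 the logarithms combine into log(1 - lam² αS/(1 + αS)), which is at least -lam² αS
because lam ≤ 1. -/
theorem rowExponent_one_ge (hS : 0 ≤ S) (hα0 : 0 ≤ α) (hα1 : α ≤ 1) (hl0 : 0 ≤ lam)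
    (hl1 : lam ≤ 1) :
    lam * capacity (α * S) - lam ^ 2 * (α * S) / 2 ≤ rowExponent S α lam 1 := by
  obtain ⟨h1, h2⟩ := rowExponent_eq hS hα0 hα1 hl0 hl1 zero_le_one le_rfl
  have hτ0 : 0 < tiltVar S α lam := zero_lt_one.trans_le (one_le_tiltVar hS hα0 hα1 hl0)
  have hA : 0 ≤ α * S := mul_nonneg hα0 hS
  have hd := (one_div_pos.2 hτ0).trans_le h1
  have hprod : tiltVar S α lam / (1 + α * S) * (1 - 1 * lam +
      1 * lam * (1 + α ^ 2 * S * (1 - 1 * lam)) / tiltVar S α lam) =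
      1 - lam ^ 2 * (α * S) / (1 + α * S) := by
    have hA' : 1 + α * S ≠ 0 := by positivity
    field_simp
    rw [tiltVar]; ring
  have hlog : -(lam ^ 2 * (α * S)) ≤ Real.log (1 - lam ^ 2 * (α * S) / (1 + α * S)) := by
    have hl2 : lam ^ 2 ≤ 1 := pow_le_one₀ hl0 hl1
    refine neg_le_log_one_sub ?_ ?_
    · rw [div_lt_one (by positivity)]; nlinarith
    · have : 1 - lam ^ 2 * (α * S) / (1 + α * S) =
          (1 + (1 - lam ^ 2) * (α * S)) / (1 + α * S) := by field_simp; ring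
      rw [this, ← mul_div_assoc]
      exact div_le_div_of_nonneg_right (le_mul_of_one_le_right (by positivity)
        (le_add_of_nonneg_right (mul_nonneg (sub_nonneg.2 hl2) hA))) (by positivity)
  rw [h2, capacity]
  rw [← hprod, Real.log_mul (by positivity) hd.ne'] at hlog
  linarith

/-- Up to a correction from the variance α²S of the shared piece αX, the determinant is the
interpolation 1 - rho + rho E. Concavity of the logarithm extracts rho log E, and E is exactly the
factor producing the `D1` objective, so rho times the binomial term can be cancelled later. -/
theorem rowExponent_ge (hS : 0 ≤ S) (hα0 : 0 ≤ α) (hα1 : α ≤ 1) (hl0 : 0 ≤ lam)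
    (hl1 : lam ≤ 1) (hr0 : 0 ≤ rho) (hr1 : rho ≤ 1) :
    rho * lam * capacity (α * S) +
        rho / 2 * Real.log (1 - lam ^ 2 * (α * (1 - α) * S / (1 + α * S))) -
        (rho * lam) ^ 2 * (α ^ 2 * S) / 2 ≤ rowExponent S α lam rho := by
  obtain ⟨h1, h2⟩ := rowExponent_eq hS hα0 hα1 hl0 hl1 hr0 hr1
  have hτ1 := one_le_tiltVar hS hα0 hα1 hl0
  have hτ0 : 0 < tiltVar S α lam := zero_lt_one.trans_le hτ1
  have hA : 0 ≤ α * S := mul_nonneg hα0 hS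
  have hA' : 1 + α * S ≠ 0 := by positivity
  have hA2 : 0 ≤ α ^ 2 * S := by positivity
  have hd := (one_div_pos.2 hτ0).trans_le h1
  set D := 1 - rho * lam + rho * lam * (1 + α ^ 2 * S * (1 - rho * lam)) / tiltVar S α lam with hD
  set E := 1 - lam * (1 - (1 + α ^ 2 * S) / tiltVar S α lam) with hE
  have hl2 : lam ^ 2 * (1 - α) ≤ 1 := mul_le_one₀ (pow_le_one₀ hl0 hl1) (by linarith) (by linarith)
  have hs : 0 < 1 - lam ^ 2 * (α * (1 - α) * S / (1 + α * S)) := by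
    have : 1 - lam ^ 2 * (α * (1 - α) * S / (1 + α * S)) =
        (1 + (1 - lam ^ 2 * (1 - α)) * (α * S)) / (1 + α * S) := by field_simp; ring
    rw [this]
    have := mul_nonneg (sub_nonneg.2 hl2) hA
    positivity
  have hEs : E * (tiltVar S α lam / (1 + α * S)) =
      1 - lam ^ 2 * (α * (1 - α) * S / (1 + α * S)) := by
    rw [hE]; field_simp; rw [tiltVar]; ring
  have hτA : 0 < tiltVar S α lam / (1 + α * S) := by positivity
  have hE0 : 0 < E := by
    have : E = (1 - lam ^ 2 * (α * (1 - α) * S / (1 + α * S))) /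
      (tiltVar S α lam / (1 + α * S)) := by rw [← hEs, mul_div_cancel_right₀ _ hτA.ne']
    rw [this]; positivity
  have hconc : rho * Real.log E ≤ Real.log (1 - rho + rho * E) := by
    have h := strictConcaveOn_log_Ioi.concaveOn.2 (Set.mem_Ioi.2 hE0)
      (Set.mem_Ioi.2 one_pos) hr0 (sub_nonneg.2 hr1) (by ring)
    simp only [smul_eq_mul, Real.log_one, mul_zero, add_zero, mul_one] at h
    rwa [add_comm (1 - rho)]
  have hw : D = 1 - rho + rho * E - (rho * lam) ^ 2 * (α ^ 2 * S) / tiltVar S α lam := by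
    rw [hD, hE]; field_simp; ring
  have hw0 : 0 ≤ (rho * lam) ^ 2 * (α ^ 2 * S) / tiltVar S α lam := by positivity
  have hF0 : 0 < 1 - rho + rho * E := by linarith
  -- The removed correction has denominator τ, and D ≥ 1/τ; relative to D it is at most (rho lam)²
  -- α²S.
  have hlogD : Real.log (1 - rho + rho * E) - (rho * lam) ^ 2 * (α ^ 2 * S) ≤ Real.log D := by
    have h3 : Real.log ((1 - rho + rho * E) / D) ≤ (1 - rho + rho * E) / D - 1 :=
      Real.log_le_sub_one_of_pos (div_pos hF0 hd)
    rw [Real.log_div hF0.ne' hd.ne'] at h3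
    have h4 : (1 - rho + rho * E) / D - 1 ≤ (rho * lam) ^ 2 * (α ^ 2 * S) := by
      rw [div_sub_one hd.ne', div_le_iff₀ hd, hw, sub_sub_cancel, ← hw, div_eq_mul_one_div]
      gcongr
    linarith
  rw [h2, capacity, ← hEs, Real.log_mul hE0.ne' hτA.ne']
  linarith

end Exponent

/-! ### The two specialisations: direct (rho = 1) and tilted (rho lam = μ). -/

section WeightBounds

variable {n L M k : ℕ} {P σ S α R : ℝ}

/-- The event that some message differing from `m` in exactly `k` sections is at least as likely
as `m`. -/
def weightEvent (n : ℕ) {L M : ℕ} (P : ℝ) (k : ℕ) (m : Fin L → Fin M) :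
    Set ((Fin n → Fin L × Fin M → ℝ) × (Fin n → ℝ)) :=
  {p | ∃ m' : Fin L → Fin M, (Finset.univ.filter fun l => m' l ≠ m l).card = k ∧
    sqDist p.1 (codeword p.1 (messageVector (flatCoeff n L P) m) + p.2)
        (messageVector (flatCoeff n L P) m') ≤
      sqDist p.1 (codeword p.1 (messageVector (flatCoeff n L P) m) + p.2)
        (messageVector (flatCoeff n L P) m)}

theorem weightEvent_le {lam rho : ℝ} (hn : 1 ≤ n) (hL : 0 < L) (hM : 2 ≤ M) (hk : k ≤ L)
    (hP : 0 < P) (hσ : 0 < σ) (hS : S = P / σ ^ 2) (hα : α = k / L)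
    (hR : (L : ℝ) * Real.log M = n * R)
    (hl0 : 0 ≤ lam) (hl1 : lam ≤ 1) (hr0 : 0 ≤ rho) (hr1 : rho ≤ 1) (m : Fin L → Fin M) :
    ((dictionaryLaw n L M).prod (noiseLaw n σ)) (weightEvent n P k m) ≤
      ENNReal.ofReal (Real.exp (rho * Real.log (L.choose k) -
        n * (rowExponent S α lam rho - rho * lam * (α * R)))) := by
  refine (weight_event_le hn hL hM hk hP hσ hS hα hl0 hl1 hr0 hr1 m).trans_eq ?_
  have hB : (0 : ℝ) < L.choose k := by exact_mod_cast Nat.choose_pos hk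
  have hM0 : (0 : ℝ) < M := by positivity
  have hL0 : (L : ℝ) ≠ 0 := by positivity
  congr 1
  rw [Real.rpow_def_of_pos hB, Real.rpow_def_of_pos (by positivity), Real.log_pow, ← Real.exp_add,
    ← Real.exp_add]
  congr 1
  have : k * Real.log M = n * (α * R) := by
    rw [hα]
    field_simp
    linear_combination (k : ℝ) * hR
  rw [this]
  ring

theorem weightEvent_le_direct {lam : ℝ} (hn : 1 ≤ n) (hL : 0 < L) (hM : 2 ≤ M) (hk : k ≤ L)
    (hP : 0 < P) (hσ : 0 < σ) (hS : S = P / σ ^ 2) (hα : α = k / L)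
    (hR : (L : ℝ) * Real.log M = n * R) (hl0 : 0 ≤ lam) (hl1 : lam ≤ 1) (m : Fin L → Fin M) :
    ((dictionaryLaw n L M).prod (noiseLaw n σ)) (weightEvent n P k m) ≤
      ENNReal.ofReal (Real.exp (Real.log (L.choose k) -
        n * (lam * (capacity (α * S) - α * R) - lam ^ 2 * (α * S) / 2))) := by
  refine (weightEvent_le hn hL hM hk hP hσ hS hα hR hl0 hl1 zero_le_one le_rfl m).trans ?_
  have hL' : (0 : ℝ) < L := by exact_mod_cast hL
  have h := rowExponent_one_ge (S := S) (α := α) (lam := lam) (by rw [hS]; positivity)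
    (by rw [hα]; positivity) (by rw [hα, div_le_one hL']; exact_mod_cast hk) hl0 hl1
  have h3 := mul_le_mul_of_nonneg_left h (Nat.cast_nonneg (α := ℝ) n)
  exact ENNReal.ofReal_le_ofReal (Real.exp_le_exp.2 (by linarith))

/-- With rho = μ/lam, the assumption on log C(L,k) multiplied by rho cancels both the number of sets
U and the capacity gap, so that only α(C - R) remains against the quadratic penalty. -/
theorem weightEvent_le_tilted {lam μ : ℝ} (hn : 1 ≤ n) (hL : 0 < L) (hM : 2 ≤ M) (hk : k ≤ L)
    (hP : 0 < P) (hσ : 0 < σ) (hS : S = P / σ ^ 2) (hα : α = k / L)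
    (hR : (L : ℝ) * Real.log M = n * R) (hl1 : lam ≤ 1) (hμ0 : 0 ≤ μ)
    (hμ : μ ≤ lam)
    (hB : Real.log (L.choose k) ≤ n * (lam * (capacity (α * S) - α * capacity S) +
      1 / 2 * Real.log (1 - lam ^ 2 * (α * (1 - α) * S / (1 + α * S))))) (m : Fin L → Fin M) :
    ((dictionaryLaw n L M).prod (noiseLaw n σ)) (weightEvent n P k m) ≤
      ENNReal.ofReal (Real.exp
        (-(n * (μ * (α * (capacity S - R)) - μ ^ 2 * (α ^ 2 * S) / 2)))) := by
  have hl0 := hμ0.trans hμ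
  obtain ⟨rho, hr0, hr1, rfl⟩ : ∃ rho, 0 ≤ rho ∧ rho ≤ 1 ∧ μ = rho * lam := by
    rcases hl0.eq_or_lt with h | h
    · exact ⟨0, le_rfl, zero_le_one, by linarith⟩
    · exact ⟨μ / lam, by positivity, (div_le_one h).2 hμ, by field_simp⟩
  refine (weightEvent_le hn hL hM hk hP hσ hS hα hR hl0 hl1 hr0 hr1 m).trans ?_
  have hL' : (0 : ℝ) < L := by exact_mod_cast hL
  have h := rowExponent_ge (S := S) (α := α) (lam := lam) (by rw [hS]; positivity)
    (by rw [hα]; positivity) (by rw [hα, div_le_one hL']; exact_mod_cast hk) hl0 hl1 hr0 hr1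
  have h2 := mul_le_mul_of_nonneg_left hB hr0
  have h3 := mul_le_mul_of_nonneg_left h (Nat.cast_nonneg (α := ℝ) n)
  gcongr
  linarith

end WeightBounds

/-! ### Bounds on the capacity gap C_α - αC. -/

section Capacity

theorem nonneg_of_hasDerivAt_nonneg {F F' : ℝ → ℝ} (h0 : F 0 = 0)
    (hF : ∀ t, 0 ≤ t → HasDerivAt F (F' t) t) (hF' : ∀ t, 0 ≤ t → 0 ≤ F' t) {v : ℝ} (hv : 0 ≤ v) :
    0 ≤ F v := by
  have hmono : MonotoneOn F (Set.Ici 0) := by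
    refine monotoneOn_of_deriv_nonneg (convex_Ici 0)
      (fun t ht => (hF t ht).continuousAt.continuousWithinAt) ?_ ?_
    · intro t ht
      rw [interior_Ici] at ht
      exact (hF t (le_of_lt ht)).differentiableAt.differentiableWithinAt
    · intro t ht
      rw [interior_Ici] at ht
      rw [(hF t (le_of_lt ht)).deriv]
      exact hF' t (le_of_lt ht)
  rw [← h0]
  exact hmono Set.self_mem_Ici hv hv

theorem hasDerivAt_log_one_add_mul {a t : ℝ} (h : 0 < 1 + a * t) :
    HasDerivAt (fun t => Real.log (1 + a * t)) (a / (1 + a * t)) t := by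
  have h1 : HasDerivAt (fun t => 1 + a * t) a t := by
    simpa using ((hasDerivAt_id t).const_mul a).const_add 1
  exact h1.log h.ne'

variable {α v : ℝ}

/-- Both sides vanish at v = 0 and the derivative of the difference in v is an explicit nonnegative
rational function. The left side is v/(4(1 + v)) times the second argument of `D1`, the form needed
to compare slopes in `gap_slope`. -/
theorem capacity_gap_ge (hα0 : 0 ≤ α) (hα1 : α ≤ 1) (hv : 0 ≤ v) :
    α * (1 - α) * v ^ 2 / (4 * (1 + v) * (1 + α * v)) ≤ capacity (α * v) - α * capacity v := by
  have h1α := sub_nonneg.2 hα1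
  have key := nonneg_of_hasDerivAt_nonneg
    (F := fun t => 1 / 2 * Real.log (1 + α * t) - α * (1 / 2 * Real.log (1 + 1 * t)) -
      α * (1 - α) * t ^ 2 / (4 * (1 + 1 * t) * (1 + α * t)))
    (F' := fun t => α * (1 - α) * t ^ 2 * (1 + α + 2 * α * t) /
      (4 * (1 + 1 * t) ^ 2 * (1 + α * t) ^ 2)) (by simp) ?_ ?_ hv
  · simp only [one_mul] at key
    rw [capacity, capacity]
    linarith
  · intro t ht
    have hp1 : 0 < 1 + 1 * t := by linarith
    have hp2 : 0 < 1 + α * t := by positivity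
    have hd1 := (hasDerivAt_log_one_add_mul hp2).const_mul (1 / 2)
    have hd2 := ((hasDerivAt_log_one_add_mul hp1).const_mul (1 / 2)).const_mul α
    have hl (a : ℝ) : HasDerivAt (fun t => 1 + a * t) a t := by
      simpa using ((hasDerivAt_id t).const_mul a).const_add 1
    have hd3 := ((hasDerivAt_pow 2 t).const_mul (α * (1 - α))).div
      (((hl 1).const_mul 4).mul (hl α))
      (show 4 * (1 + 1 * t) * (1 + α * t) ≠ 0 by positivity)
    refine ((hd1.sub hd2).sub hd3).congr_deriv ?_
    simp only [Pi.mul_apply]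
    field_simp
    ring
  · intro t ht
    positivity

theorem capacity_gap_le (hα0 : 0 ≤ α) (hα1 : α ≤ 1) (hv : 0 ≤ v) :
    capacity (α * v) - α * capacity v ≤ α * (1 - α) * v ^ 2 / 4 := by
  have h1α := sub_nonneg.2 hα1
  have key := nonneg_of_hasDerivAt_nonneg
    (F := fun t => α * (1 - α) / 4 * t ^ 2 -
      (1 / 2 * Real.log (1 + α * t) - α * (1 / 2 * Real.log (1 + 1 * t))))
    (F' := fun t => α * (1 - α) * t ^ 2 * (1 + α + α * t) /
      (2 * (1 + 1 * t) * (1 + α * t))) (by simp) ?_ ?_ hv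
  · simp only [one_mul] at key
    rw [capacity, capacity]
    linarith
  · intro t ht
    have hp1 : 0 < 1 + 1 * t := by linarith
    have hp2 : 0 < 1 + α * t := by positivity
    have hd1 := (hasDerivAt_log_one_add_mul hp2).const_mul (1 / 2)
    have hd2 := ((hasDerivAt_log_one_add_mul hp1).const_mul (1 / 2)).const_mul α
    refine (((hasDerivAt_pow 2 t).const_mul (α * (1 - α) / 4)).sub (hd1.sub hd2)).congr_deriv ?_
    field_simp
    ring
  · intro t ht
    positivity

/-- Controls how fast the normalised gap ξ decreases in α, to pass from one wrong section to k of
them. -/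
theorem log_div_sub_log_div_le {a b : ℝ} (ha : 0 < a) (hab : a ≤ b) (hv : 0 ≤ v) :
    Real.log (1 + a * v) / a - Real.log (1 + b * v) / b ≤ (b - a) * v ^ 2 / 2 := by
  have hb := ha.trans_le hab
  have hab' := sub_nonneg.2 hab
  have key := nonneg_of_hasDerivAt_nonneg
    (F := fun t => (b - a) / 2 * t ^ 2 -
      (Real.log (1 + a * t) / a - Real.log (1 + b * t) / b))
    (F' := fun t => (b - a) * t ^ 2 * (a + b + a * b * t) /
      ((1 + a * t) * (1 + b * t))) (by simp) ?_ ?_ hv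
  · linarith
  · intro t ht
    have hp1 : 0 < 1 + a * t := by positivity
    have hp2 : 0 < 1 + b * t := by positivity
    have hd1 := (hasDerivAt_log_one_add_mul hp1).div_const a
    have hd2 := (hasDerivAt_log_one_add_mul hp2).div_const b
    refine (((hasDerivAt_pow 2 t).const_mul ((b - a) / 2)).sub (hd1.sub hd2)).congr_deriv ?_
    field_simp
    ring
  · intro t ht
    positivity

end Capacity

/-! ### The constants w and h. -/

section Constants

variable {v : ℝ}

theorem w_pos (hv : 0 < v) : 0 < w v := by
  rw [w]; positivity

/-- Here r is half the square root in w; this isolates v/(4(1 + v)), the slope in `capacity_gap_ge`.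
-/
theorem exists_w_eq (hv : 0 < v) : ∃ r : ℝ, 1 ≤ r ∧ r ^ 2 = 1 + v ^ 3 / (4 * (1 + v)) ∧
    (1 + v) * w v * r = v / (4 * (1 + v)) := by
  refine ⟨√(1 + v ^ 3 / (4 * (1 + v))), ?_, Real.sq_sqrt (by positivity), ?_⟩
  · rw [Real.one_le_sqrt]
    have : 0 ≤ v ^ 3 / (4 * (1 + v)) := by positivity
    linarith
  · have : √(4 + v ^ 3 / (1 + v)) = 2 * √(1 + v ^ 3 / (4 * (1 + v))) := by
      rw [show 4 + v ^ 3 / (1 + v) = 2 ^ 2 * (1 + v ^ 3 / (4 * (1 + v))) by field_simp; norm_num,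
        Real.sqrt_mul (by norm_num), Real.sqrt_sq (by norm_num)]
    rw [w, this]
    field_simp
    norm_num

theorem one_add_mul_w_le (hv : 0 < v) : (1 + v) * w v ≤ v / (4 * (1 + v)) := by
  obtain ⟨r, hr1, -, hr⟩ := exists_w_eq hv
  have := w_pos hv
  rw [← hr]
  exact le_mul_of_one_le_right (by positivity) hr1

theorem one_add_mul_w_le_one (hv : 0 < v) : (1 + v) * w v ≤ 1 := by
  refine (one_add_mul_w_le hv).trans ?_
  rw [div_le_one (by positivity)]
  linarith

theorem h_le_left {ε α Δ : ℝ} (hv : 0 < v) (hΔ : 0 ≤ Δ) (hεα : ε ≤ α) :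
    h v ε Δ ≤ α * Δ * w v := by
  have := w_pos hv
  refine (min_le_left _ _).trans ?_
  gcongr

theorem h_le_right {ε Δ : ℝ} (hv : 0 < v) : h v ε Δ ≤ Δ ^ 2 / (8 * v) := by
  refine (min_le_right _ _).trans ?_
  have hg (x : ℝ) : g x ≤ 2 * x ^ 2 := by
    rw [g, sub_le_iff_le_add, Real.sqrt_le_left (by positivity)]
    nlinarith [sq_nonneg (x ^ 2)]
  have h1 := hg (Δ / (2 * √v))
  rw [div_pow, mul_pow, Real.sq_sqrt hv.le] at h1
  calc 1 / 4 * g (Δ / (2 * √v)) ≤ 1 / 4 * (2 * (Δ ^ 2 / (2 ^ 2 * v))) := by gcongr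
    _ = _ := by field_simp; ring

end Constants

/-! ### Locating the maximiser in `D1`. -/

section Maximiser

variable {α v x s : ℝ}

/-- Quantitative monotonicity of the objective, from log u ≥ 1 - 1/u at the ratio of the two
arguments. -/
theorem objective_le {t l : ℝ} (hs0 : 0 ≤ s) (ht0 : 0 ≤ t) (htl : t ≤ l) (hl : l ^ 2 * s < 1) :
    (l - t) * (x - (l + t) / 2 * s / (1 - l ^ 2 * s)) ≤
      (l * x + 1 / 2 * Real.log (1 - l ^ 2 * s)) - (t * x + 1 / 2 * Real.log (1 - t ^ 2 * s)) := by
  have hl' : 0 < 1 - l ^ 2 * s := by linarith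
  have ht' : 0 < 1 - t ^ 2 * s := by
    have : t ^ 2 * s ≤ l ^ 2 * s := by gcongr
    linarith
  have h1 := Real.one_sub_inv_le_log_of_pos (div_pos hl' ht')
  rw [Real.log_div hl'.ne' ht'.ne', inv_div] at h1
  have h2 : 1 - (1 - t ^ 2 * s) / (1 - l ^ 2 * s) =
      -(2 * ((l - t) * ((l + t) / 2 * s / (1 - l ^ 2 * s)))) := by
    have hne := hl'.ne'
    rw [one_sub_div hne]
    field_simp
    ring
  rw [h2] at h1
  linarith

/-- The last inequality says that the objective of `D1` still has nonnegative derivative at l = (1 +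
v) w. By the lower bound on the gap it reduces to r(1 - l²s) ≥ 1, which the square root in w
guarantees. -/
theorem gap_slope (hv : 0 < v) (hα0 : 0 < α) (hα1 : α < 1) :
    let s := α * (1 - α) * v / (1 + α * v)
    let l := (1 + v) * w v
    0 < s ∧ s < 1 ∧ 0 < l ∧ l ^ 2 * s < 1 ∧
      l * s / (1 - l ^ 2 * s) ≤ capacity (α * v) - α * capacity v := by
  intro s l
  have h1α := sub_pos.2 hα1
  have hw := w_pos hv
  have hs0 : 0 < s := by positivity
  have hs1 : s < 1 := by
    rw [div_lt_one (by positivity)]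
    have : 0 < α * v := by positivity
    nlinarith
  have hl0 : 0 < l := by positivity
  have hl1 : l ≤ 1 := one_add_mul_w_le_one hv
  have hls : l ^ 2 * s < 1 := by
    have : l ^ 2 ≤ 1 := pow_le_one₀ hl0.le hl1
    calc l ^ 2 * s ≤ 1 * s := by gcongr
      _ < 1 := by linarith
  refine ⟨hs0, hs1, hl0, hls, ?_⟩
  refine le_trans ?_ (capacity_gap_ge hα0.le hα1.le hv.le)
  obtain ⟨r, hr1, hr2, hr⟩ := exists_w_eq hv
  have hx0 : α * (1 - α) * v ^ 2 / (4 * (1 + v) * (1 + α * v)) = l * r * s := by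
    rw [show l * r = v / (4 * (1 + v)) from hr]
    simp only [s]
    field_simp
  rw [hx0, div_le_iff₀ (by linarith)]
  -- From s ≤ v/4; the right side is (r² - 1)/16, which is at most r(r - 1) for r ≥ 1.
  have hq : (l * r) ^ 2 * s ≤ v ^ 3 / (64 * (1 + v)) := by
    have hs4 : s ≤ v / 4 := by
      simp only [s]
      rw [div_le_div_iff₀ (by positivity) (by norm_num)]
      have : 0 ≤ (1 - 2 * α) ^ 2 * v := by positivity
      have : 0 ≤ α * v ^ 2 := by positivity
      nlinarith
    rw [show l * r = v / (4 * (1 + v)) from hr, div_pow]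
    calc v ^ 2 / (4 * (1 + v)) ^ 2 * s ≤ v ^ 2 / (4 * (1 + v)) ^ 2 * (v / 4) := by gcongr
      _ = v ^ 3 / (64 * (1 + v)) * (1 / (1 + v)) := by field_simp; norm_num
      _ ≤ v ^ 3 / (64 * (1 + v)) * 1 := by
        gcongr
        rw [div_le_one (by positivity)]; linarith
      _ = _ := by ring
  have hq2 : v ^ 3 / (64 * (1 + v)) = (r ^ 2 - 1) / 16 := by
    rw [hr2]; field_simp; ring
  have hkey : (l * r) ^ 2 * s ≤ r * (r - 1) := by nlinarith
  have hr0 : 0 < r := by linarith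
  have h5 : l ^ 2 * s * r ≤ r - 1 := by
    by_contra hcon
    push Not at hcon
    nlinarith [mul_lt_mul_of_pos_left hcon hr0]
  have : l * s * (1 + l ^ 2 * s * r) ≤ l * s * r := by gcongr; linarith
  nlinarith

/-- If a maximiser lies to the left of (1 + v) w, then that point does as well, since the objective
does not decrease up to it. Positivity of `D1` is needed to clear the denominator in
`sectionSizeRatio`. -/
theorem exists_maximiser (hv : 0 < v) (hα0 : 0 < α) (hα1 : α < 1) :
    let s := α * (1 - α) * v / (1 + α * v)
    let x := capacity (α * v) - α * capacity v
    0 < D1 x s ∧ ∃ l, (1 + v) * w v ≤ l ∧ l ≤ 1 ∧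
      D1 x s ≤ l * x + 1 / 2 * Real.log (1 - l ^ 2 * s) := by
  intro s x
  obtain ⟨hs0, hs1, hl0, hls, hslope⟩ := gap_slope hv hα0 hα1
  change 0 < s at hs0
  change s < 1 at hs1
  set l₀ := (1 + v) * w v with hl₀
  change l₀ ^ 2 * s < 1 at hls
  change l₀ * s / (1 - l₀ ^ 2 * s) ≤ x at hslope
  have hl1 : l₀ ≤ 1 := one_add_mul_w_le_one hv
  set f : ℝ → ℝ := fun t => t * x + 1 / 2 * Real.log (1 - t ^ 2 * s) with hf
  have hcont : ContinuousOn f (Set.Icc 0 1) := by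
    refine ContinuousOn.add (by fun_prop) (ContinuousOn.mul continuousOn_const
      (ContinuousOn.log (by fun_prop) fun t ht => ?_))
    have : t ^ 2 ≤ 1 := pow_le_one₀ ht.1 ht.2
    have : t ^ 2 * s ≤ 1 * s := by gcongr
    linarith
  obtain ⟨lm, hlm, hmax⟩ := isCompact_Icc.exists_isMaxOn (Set.nonempty_Icc.2 zero_le_one) hcont
  have hD1 : D1 x s ≤ f lm := by
    refine csSup_le ((Set.nonempty_Icc.2 zero_le_one).image _) ?_
    rintro _ ⟨t, ht, rfl⟩
    exact hmax ht
  have hbdd : BddAbove (f '' Set.Icc 0 1) := (isCompact_Icc.image_of_continuousOn hcont).bddAbove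
  have hx0 : 0 < x := lt_of_lt_of_le (div_pos (mul_pos hl0 hs0) (by linarith)) hslope
  refine ⟨?_, ?_⟩
  · have h1 : f l₀ ≤ D1 x s := le_csSup hbdd ⟨l₀, ⟨hl0.le, hl1⟩, rfl⟩
    have h2 := objective_le (x := x) hs0.le le_rfl hl0.le hls
    have h3 : (l₀ + 0) / 2 * s / (1 - l₀ ^ 2 * s) = l₀ * s / (1 - l₀ ^ 2 * s) / 2 := by ring
    rw [h3] at h2
    simp only [sub_zero, zero_mul, ne_eq, OfNat.ofNat_ne_zero, not_false_eq_true, zero_pow,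
      Real.log_one, mul_zero, add_zero] at h2
    have h4 : 0 < l₀ * (x - l₀ * s / (1 - l₀ ^ 2 * s) / 2) := mul_pos hl0 (by linarith)
    change _ ≤ f l₀ at h2
    linarith
  · rcases le_total l₀ lm with h | h
    · exact ⟨lm, h, hlm.2, hD1⟩
    · refine ⟨l₀, le_rfl, hl1, hD1.trans ?_⟩
      have h2 := objective_le (x := x) hs0.le hlm.1 h hls
      have h3 : (l₀ + lm) / 2 * s / (1 - l₀ ^ 2 * s) ≤ l₀ * s / (1 - l₀ ^ 2 * s) := by
        have : 0 < 1 - l₀ ^ 2 * s := by linarith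
        gcongr
        linarith
      have h4 : 0 ≤ (l₀ - lm) * (x - (l₀ + lm) / 2 * s / (1 - l₀ ^ 2 * s)) :=
        mul_nonneg (by linarith) (by linarith)
      change f lm ≤ f l₀
      simp only [hf]
      linarith

end Maximiser

/-! ### What the section-size hypothesis says about binomial coefficients. -/

section SectionSize

/-- Clearing denominators in the ratio at k gives R log C(L,k) ≤ D1 · a L log L = D1 · nR, and R > 0
cancels. -/
theorem log_choose_le {n L M k : ℕ} (hL : 2 ≤ L) {v R a : ℝ} (hv : 0 < v) (hR0 : 0 < R)
    (hR : (L : ℝ) * Real.log M = n * R) (hM : (M : ℝ) = (L : ℝ) ^ a) (ha : aStar L v R ≤ a)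
    (hk1 : 1 ≤ k) (hkL : k ≤ L) {α : ℝ} (hα : α = k / L) :
    ∃ l, (1 + v) * w v ≤ l ∧ l ≤ 1 ∧
      Real.log (L.choose k) ≤ n * (l * (capacity (α * v) - α * capacity v) +
        1 / 2 * Real.log (1 - l ^ 2 * (α * (1 - α) * v / (1 + α * v)))) := by
  have hL0 : (0 : ℝ) < L := by positivity
  -- The value k = L lies outside the range of `aStar`; there both sides are 0.
  rcases hkL.eq_or_lt with rfl | hkL'
  · refine ⟨1, one_add_mul_w_le_one hv, le_rfl, ?_⟩
    have : α = 1 := by rw [hα, div_self hL0.ne']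
    simp [this]
  have hk0 : (0 : ℝ) < k := by exact_mod_cast hk1
  have hα0 : 0 < α := by rw [hα]; positivity
  have hα1 : α < 1 := by rw [hα, div_lt_one hL0]; exact_mod_cast hkL'
  obtain ⟨hD0, l, hl0, hl1, hD⟩ := exists_maximiser hv hα0 hα1
  refine ⟨l, hl0, hl1, ?_⟩
  refine le_trans ?_ (mul_le_mul_of_nonneg_left hD (Nat.cast_nonneg _))
  have hfin : (sectionSizeRatio L v R '' Set.Ioo 0 L).Finite := (Set.finite_Ioo 0 L).image _
  have hle : sectionSizeRatio L v R k ≤ a :=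
    (le_csSup hfin.bddAbove ⟨k, ⟨hk1, hkL'⟩, rfl⟩).trans ha
  have hlogL : 0 < Real.log L := Real.log_pos (by exact_mod_cast hL)
  have hlogM : Real.log M = a * Real.log L := by rw [hM, Real.log_rpow hL0]
  rw [sectionSizeRatio] at hle
  simp only [← hα] at hle
  rw [div_le_iff₀ (by positivity)] at hle
  rw [hlogM] at hR
  refine le_of_mul_le_mul_left ?_ hR0
  calc _ ≤ _ := hle
    _ = D1 (capacity (α * v) - α * capacity v) (α * (1 - α) * v / (1 + α * v)) *
        (L * (a * Real.log L)) := by ring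
    _ = _ := by rw [hR]; ring

end SectionSize

/-! ### An elementary binomial estimate for few wrong sections. -/

section Binomial

/-- The term log 2 serves the base case k = 1, where log k! = 0; this is the origin of the factor 2
in the final bound. The induction step only needs log(k + 1) ≥ log 2 > 6/11. -/
theorem mul_log_le_log_factorial {k : ℕ} (hk : 1 ≤ k) :
    3 / 25 * k * (3 + Real.log k) ≤ Real.log 2 + Real.log k.factorial := by
  have hlog2 := Real.log_two_gt_d9
  induction k, hk using Nat.le_induction with
  | base => norm_num; linarith
  | succ k hk ih =>
    have hk0 : (0 : ℝ) < k := by exact_mod_cast hk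
    have hk1 : (1 : ℝ) ≤ k := by exact_mod_cast hk
    have h1 : k * (Real.log (k + 1) - Real.log k) ≤ 1 := by
      rw [← Real.log_div (by positivity) hk0.ne']
      have := Real.log_le_sub_one_of_pos (show (0 : ℝ) < (k + 1) / k by positivity)
      calc k * Real.log ((k + 1) / k) ≤ k * ((k + 1) / k - 1) := by gcongr
        _ = 1 := by field_simp; ring
    have h2 : Real.log 2 ≤ Real.log (k + 1) := Real.log_le_log (by norm_num) (by linarith)
    rw [Nat.factorial_succ]
    push_cast
    rw [Real.log_mul (by positivity) (by positivity)]
    nlinarith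

/-- From C(L,k) ≤ L^k/k!. Since log L / L decreases beyond e, the worst case is L = 20k, where 12/5
divided by 20 gives 3/25, and log 20 ≤ 3. -/
theorem log_choose_le_of_twenty_mul_le {L k : ℕ} (hk : 1 ≤ k) (hL : 20 * k ≤ L) :
    Real.log (L.choose k) ≤ Real.log 2 + (1 - 12 / 5 * (k / L : ℝ)) * (k * Real.log L) := by
  have hk0 : (0 : ℝ) < k := by exact_mod_cast hk
  have hk1 : (1 : ℝ) ≤ k := by exact_mod_cast hk
  have hLR : (20 : ℝ) * k ≤ L := by exact_mod_cast hL
  have hL0 : (0 : ℝ) < L := by linarith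
  have hch : Real.log (L.choose k) ≤ k * Real.log L - Real.log k.factorial := by
    have h := Nat.choose_le_pow_div (α := ℝ) k L
    have hpos : (0 : ℝ) < L.choose k := by
      exact_mod_cast Nat.choose_pos (by omega)
    refine (Real.log_le_log hpos h).trans_eq ?_
    rw [Real.log_div (by positivity) (by positivity), Real.log_pow]
  have he : Real.exp 1 ≤ 20 * k := by
    have := Real.exp_one_lt_d9
    linarith
  have hanti : Real.log L / L ≤ Real.log (20 * k) / (20 * k) :=
    Real.log_div_self_antitoneOn he (he.trans hLR) hLR
  have h20 : Real.log 20 ≤ 3 := by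
    rw [Real.log_le_iff_le_exp (by norm_num), show (3 : ℝ) = (3 : ℕ) * 1 by norm_num,
      Real.exp_nat_mul]
    have := Real.exp_one_gt_d9
    calc (20 : ℝ) ≤ 2.7182 ^ 3 := by norm_num
      _ ≤ _ := by gcongr; linarith
  have h1 : 12 / 5 * (k / L : ℝ) * (k * Real.log L) ≤ 3 / 25 * k * (3 + Real.log k) := by
    calc 12 / 5 * (k / L : ℝ) * (k * Real.log L) = 12 / 5 * k ^ 2 * (Real.log L / L) := by ring
      _ ≤ 12 / 5 * k ^ 2 * (Real.log (20 * k) / (20 * k)) := by gcongr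
      _ = 3 / 25 * k * (Real.log 20 + Real.log k) := by
        rw [Real.log_mul (by norm_num) hk0.ne']; field_simp; ring
      _ ≤ _ := by gcongr
  have := mul_log_le_log_factorial hk
  linarith

end Binomial

/-! ### Comparison of the exponents with h. -/

section Cases

variable {α v Δ ξ η : ℝ}

/-- The unconstrained optimum is μ = Δ/(αv), but only μ ≤ (1 + v) w is known to be allowed. Three
ranges of Δ against q = wαv use the optimum, w, and 11w/10. -/
theorem exists_tilt (hv : 0 < v) (hα : 0 < α) (hΔ : 0 < Δ)
    (hcase : Δ ≤ 7 * (w v * α * v) ∨ 1 / 10 ≤ v) (h1 : η ≤ α * Δ * w v)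
    (h2 : η ≤ Δ ^ 2 / (8 * v)) :
    ∃ μ, 0 ≤ μ ∧ μ ≤ (1 + v) * w v ∧ η ≤ μ * (α * Δ) - μ ^ 2 * (α ^ 2 * v) / 2 := by
  have hw := w_pos hv
  rw [le_div_iff₀ (by positivity)] at h2
  generalize w v = w at *
  by_cases hA : Δ ≤ w * α * v
  · refine ⟨Δ / (α * v), by positivity, ?_, ?_⟩
    · rw [div_le_iff₀ (by positivity)]
      nlinarith [show 0 < v * w * α * v by positivity]
    · have : Δ / (α * v) * (α * Δ) - (Δ / (α * v)) ^ 2 * (α ^ 2 * v) / 2 = Δ ^ 2 / (2 * v) := by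
        field_simp; ring
      rw [this, le_div_iff₀ (by positivity)]
      nlinarith [sq_nonneg Δ]
  push Not at hA
  by_cases hB : Δ ≤ 7 * (w * α * v)
  · refine ⟨w, hw.le, by nlinarith, ?_⟩
    have h3 : 0 ≤ (Δ - w * α * v) * (7 * (w * α * v) - Δ) := mul_nonneg (by linarith) (by linarith)
    have h4 : η * (8 * v) ≤ (w * (α * Δ) - w ^ 2 * (α ^ 2 * v) / 2) * (8 * v) := by
      nlinarith [sq_nonneg (w * α * v)]
    exact le_of_mul_le_mul_right h4 (by positivity)
  · have hv10 := hcase.resolve_left hB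
    push Not at hB
    -- Allowed because v ≥ 1/10; the surplus wαΔ/10 exceeds the quadratic loss once Δ ≥ 7q.
    refine ⟨11 / 10 * w, by positivity, by nlinarith, ?_⟩
    have : w * α * (7 * (w * α * v)) ≤ w * α * Δ := by gcongr
    nlinarith [show 0 < w ^ 2 * α ^ 2 * v by positivity]

/-- Makes the cross term 2ξΔ of (ξ + Δ)² cover 2vwΔ, the contribution of αΔw, up to αv²Δ/2. -/
theorem gap_slope_ge (hv : 0 < v) (hα0 : 0 < α)
    (hξ : (1 - α) * v ^ 2 / (4 * (1 + v) * (1 + α * v)) ≤ ξ) : -(α * v ^ 2 / 4) ≤ ξ - v * w v := by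
  have h1 : v * w v ≤ v ^ 2 / (4 * (1 + v) ^ 2) := by
    have := one_add_mul_w_le hv
    rw [le_div_iff₀ (by positivity)] at this ⊢
    nlinarith
  have h2 : v ^ 2 / (4 * (1 + v) ^ 2) - α * v ^ 2 / 4 ≤
      (1 - α) * v ^ 2 / (4 * (1 + v) * (1 + α * v)) := by
    rw [← sub_nonneg]
    have : (1 - α) * v ^ 2 / (4 * (1 + v) * (1 + α * v)) -
        (v ^ 2 / (4 * (1 + v) ^ 2) - α * v ^ 2 / 4) =
        v ^ 2 * (v + α * v ^ 2 + α ^ 2 * v * (1 + v) ^ 2) / (4 * (1 + v) ^ 2 * (1 + α * v)) := by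
      field_simp; ring
    rw [this]
    positivity
  linarith

/-- With Δ ≥ 7wαv this yields Δ ≥ (10/7) αv², enough to absorb the defect in `gap_slope_ge`. -/
theorem w_ge (hv : 0 < v) (hv1 : v < 1 / 10) : 10 / 49 * v ≤ w v := by
  obtain ⟨r, hr1, hr2, hr⟩ := exists_w_eq hv
  have hw := w_pos hv
  have hr3 : r ≤ 1001 / 1000 := by
    have h3 : v ^ 3 / (4 * (1 + v)) ≤ 1 / 4000 := by
      rw [div_le_div_iff₀ (by positivity) (by norm_num)]
      have : v ^ 3 ≤ (1 / 10) ^ 3 := by gcongr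
      linarith
    nlinarith
  rw [eq_div_iff (by positivity)] at hr
  have h1 : (1 + v) ^ 2 * r ≤ (11 / 10) ^ 2 * (1001 / 1000) := by gcongr; linarith
  have h2 : w v * ((1 + v) ^ 2 * r) ≤ w v * ((11 / 10) ^ 2 * (1001 / 1000)) := by gcongr
  nlinarith

theorem mul_sub_le_sq_div {l x s : ℝ} (hs : 0 < s) (hl : l ^ 2 * s < 1) :
    l * x + 1 / 2 * Real.log (1 - l ^ 2 * s) ≤ x ^ 2 / (2 * s) := by
  have h1 := Real.log_le_sub_one_of_pos (show 0 < 1 - l ^ 2 * s by linarith)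
  rw [le_div_iff₀ (by positivity)]
  nlinarith [sq_nonneg (x - l * s)]

/-- The direct union bound suffices for small `snr`, when `α ≥ 1/20`. -/
theorem direct_exponent_large {c : ℝ} (hv : 0 < v) (hv1 : v < 1 / 10) (hα0 : 1 / 20 ≤ α)
    (hα1 : α < 1)
    (hΔ : 7 * (w v * α * v) ≤ Δ)
    (hξ1 : (1 - α) * v ^ 2 / (4 * (1 + v) * (1 + α * v)) ≤ ξ) (hξ2 : ξ ≤ (1 - α) * v ^ 2 / 4)
    (hc : c ≤ (α * ξ) ^ 2 / (2 * (α * (1 - α) * v / (1 + α * v)))) :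
    c + α * Δ * w v ≤ α * (ξ + Δ) ^ 2 / (2 * v) := by
  have hα : 0 < α := by linarith
  have h1α := sub_pos.2 hα1
  have hgap := gap_slope_ge hv hα hξ1
  have hw := w_ge hv hv1
  have hΔ' : 10 / 7 * (α * v ^ 2) ≤ Δ := by
    refine le_trans ?_ hΔ
    have : 10 / 49 * v * (α * v) ≤ w v * (α * v) := by gcongr
    nlinarith
  have hξ0 : 0 ≤ ξ := le_trans (by positivity) hξ1
  have hΔ0 : 0 ≤ Δ := le_trans (by positivity) hΔ'
  have e1 : (α * ξ) ^ 2 / (2 * (α * (1 - α) * v / (1 + α * v))) =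
      α * (ξ ^ 2 + ξ * (α * (1 + v)) * (ξ / (1 - α))) / (2 * v) := by
    field_simp; ring
  have h2 : ξ / (1 - α) ≤ v ^ 2 / 4 := by
    rw [div_le_iff₀ h1α]; linarith
  have h3 : ξ * (α * (1 + v)) * (ξ / (1 - α)) ≤
      ((1 - α) * v ^ 2 / 4) * (α * (11 / 10)) * (v ^ 2 / 4) := by
    gcongr; linarith
  have h4 : ((1 - α) * v ^ 2 / 4) * (α * (11 / 10)) * (v ^ 2 / 4) ≤
      (α * v ^ 2) ^ 2 * (65 / 49) := by
    have : (1 - α) * (11 / 10) / 16 ≤ α * (65 / 49) := by linarith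
    -- The previous comparison of constants is where α ≥ 1/20 is needed; 65/49 is 10/7 · 13/14.
    calc _ = α * v ^ 4 * ((1 - α) * (11 / 10) / 16) := by ring
      _ ≤ α * v ^ 4 * (α * (65 / 49)) := by gcongr
      _ = _ := by ring
  have h5 : (α * v ^ 2) ^ 2 * (65 / 49) ≤ Δ * (Δ - α * v ^ 2 / 2) := by
    have : 10 / 7 * (α * v ^ 2) * (13 / 14 * (α * v ^ 2)) ≤ Δ * (Δ - α * v ^ 2 / 2) := by
      gcongr; linarith
    linarith
  have h6 : Δ * (Δ - α * v ^ 2 / 2) ≤ Δ * (Δ + 2 * (ξ - v * w v)) := by gcongr; linarith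
  have h7 : ξ ^ 2 + ξ * (α * (1 + v)) * (ξ / (1 - α)) + 2 * (v * w v) * Δ ≤ (ξ + Δ) ^ 2 := by
    linarith
  calc c + α * Δ * w v ≤ α * (ξ ^ 2 + ξ * (α * (1 + v)) * (ξ / (1 - α))) / (2 * v) +
        α * Δ * w v := by rw [← e1]; gcongr
    _ = α * (ξ ^ 2 + ξ * (α * (1 + v)) * (ξ / (1 - α)) + 2 * (v * w v) * Δ) / (2 * v) := by
        field_simp
    _ ≤ _ := by gcongr

/-- The direct union bound suffices for small `snr`, when `α < 1/20`; here `β = 1 / L`, `ξ₁` is the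
value of `ξ` at `β`, and `ℓ = log L`. -/
theorem direct_exponent_small {β ξ₁ N ℓ b : ℝ} (hv : 0 < v) (hv1 : v < 1 / 10) (hβ : 0 < β)
    (hβα : β ≤ α) (hα : α < 1 / 20) (hN : 0 ≤ N)
    (hΔ : 7 * (w v * α * v) ≤ Δ)
    (hξ1 : (1 - α) * v ^ 2 / (4 * (1 + v) * (1 + α * v)) ≤ ξ)
    (hξ₁ : (1 - β) * v ^ 2 / (4 * (1 + v) * (1 + β * v)) ≤ ξ₁)
    (hξξ : ξ₁ - ξ ≤ (α - β) * v ^ 2 / 4)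
    (hℓN : ℓ ≤ N * ((β * ξ₁) ^ 2 / (2 * (β * (1 - β) * v / (1 + β * v)))))
    (hb : b ≤ Real.log 2 + (1 - 12 / 5 * α) * (α / β * ℓ)) :
    b + N * (α * Δ * w v) ≤ Real.log 2 + N * (α * (ξ + Δ) ^ 2 / (2 * v)) := by
  have hα0 : 0 < α := hβ.trans_le hβα
  have h1β : 0 < 1 - β := by linarith
  have h1α : 0 < 1 - α := by linarith
  have hgap := gap_slope_ge hv hα0 hξ1
  have hw := w_ge hv hv1
  have hΔ' : 10 / 7 * (α * v ^ 2) ≤ Δ := by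
    refine le_trans ?_ hΔ
    have : 10 / 49 * v * (α * v) ≤ w v * (α * v) := by gcongr
    nlinarith
  have hΔ0 : 0 ≤ Δ := le_trans (by positivity) hΔ'
  have hξ0 : 0 < ξ := lt_of_lt_of_le (by positivity) hξ1
  have hξ₁0 : 0 < ξ₁ := lt_of_lt_of_le (by positivity) hξ₁
  have hαv : 0 < α * v ^ 2 := by positivity
  have h1 : ξ ^ 2 + 2 * (v * w v) * Δ ≤ (ξ + Δ) ^ 2 := by
    have : 0 ≤ Δ * (Δ + 2 * (ξ - v * w v)) := mul_nonneg hΔ0 (by linarith)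
    linarith
  have h2 : v ^ 2 / 4 ≤ 117 / 100 * ξ₁ := by
    rw [div_le_iff₀ (by positivity)] at hξ₁
    have hβv : β * v ≤ 1 / 200 := by
      calc β * v ≤ 1 / 20 * (1 / 10) := by gcongr; linarith
        _ = 1 / 200 := by norm_num
    have h3 : (1 + v) * (1 + β * v) ≤ 11 / 10 * (201 / 200) := by gcongr <;> linarith
    have h4 : ξ₁ * ((1 + v) * (1 + β * v)) ≤ ξ₁ * (11 / 10 * (201 / 200)) := by gcongr
    have h5 : 19 / 20 * v ^ 2 ≤ (1 - β) * v ^ 2 := by gcongr; linarith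
    linarith
  have h3 : ξ₁ * (1 - 117 / 100 * (α - β)) ≤ ξ := by
    have : (α - β) * (v ^ 2 / 4) ≤ (α - β) * (117 / 100 * ξ₁) :=
      mul_le_mul_of_nonneg_left h2 (by linarith)
    linarith
  -- Passing from β to α costs a factor at most (1 - 1.17(α - β))² in ξ², that is about 2.34 α; the
  -- saving 12/5 = 2.4 in the binomial estimate outweighs it.
  have h4 : (1 - 12 / 5 * α) * (1 + β * v) * ξ₁ ^ 2 ≤ (1 - β) * ξ ^ 2 := by
    have h5 : (ξ₁ * (1 - 117 / 100 * (α - β))) ^ 2 ≤ ξ ^ 2 := by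
      have : 0 ≤ 1 - 117 / 100 * (α - β) := by linarith
      gcongr
    have h6 : 1 - 234 / 100 * (α - β) ≤ (1 - 117 / 100 * (α - β)) ^ 2 := by
      nlinarith [sq_nonneg (α - β)]
    have h7 : (1 - 12 / 5 * α) * (1 + β * v) ≤ (1 - β) * (1 - 234 / 100 * (α - β)) := by
      have h8 : (1 - 12 / 5 * α) * (1 + β * v) ≤ (1 - 12 / 5 * α) * (1 + β * (1 / 10)) := by
        have : 0 ≤ 1 - 12 / 5 * α := by linarith
        gcongr
      have h9 : 0 ≤ β * (α - β) := mul_nonneg hβ.le (by linarith)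
      have h10 : 0 ≤ α * β := by positivity
      linarith
    calc (1 - 12 / 5 * α) * (1 + β * v) * ξ₁ ^ 2
        ≤ (1 - β) * (1 - 234 / 100 * (α - β)) * ξ₁ ^ 2 := by gcongr
      _ ≤ (1 - β) * (1 - 117 / 100 * (α - β)) ^ 2 * ξ₁ ^ 2 := by gcongr
      _ = (1 - β) * (ξ₁ * (1 - 117 / 100 * (α - β))) ^ 2 := by ring
      _ ≤ _ := by gcongr
  have h5 : (1 - 12 / 5 * α) * (α / β * ℓ) ≤ N * (α * ξ ^ 2 / (2 * v)) := by
    have h12 : 0 ≤ 1 - 12 / 5 * α := by linarith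
    calc (1 - 12 / 5 * α) * (α / β * ℓ)
        ≤ (1 - 12 / 5 * α) * (α / β *
          (N * ((β * ξ₁) ^ 2 / (2 * (β * (1 - β) * v / (1 + β * v)))))) := by gcongr
      _ = N * (α * (((1 - 12 / 5 * α) * (1 + β * v) * ξ₁ ^ 2) / (1 - β)) / (2 * v)) := by
          field_simp
      _ ≤ N * (α * ξ ^ 2 / (2 * v)) := by
          gcongr
          rw [div_le_iff₀ h1β]; linarith
  have h6 : α * ξ ^ 2 / (2 * v) + α * Δ * w v ≤ α * (ξ + Δ) ^ 2 / (2 * v) := by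
    calc _ = α * (ξ ^ 2 + 2 * (v * w v) * Δ) / (2 * v) := by field_simp
      _ ≤ _ := by gcongr
  have h7 := mul_le_mul_of_nonneg_left h6 hN
  linarith

end Cases

/-! ### The bound for a fixed number of wrong sections. -/

section WeightEventBound

variable {n L M k : ℕ} {P σ S R a Δ ε : ℝ}

theorem capacity_le_half {v : ℝ} (hv : 0 ≤ v) : capacity v ≤ v / 2 := by
  have := Real.log_le_sub_one_of_pos (show 0 < 1 + v by linarith)
  rw [capacity]; linarith

theorem exists_gap_eq {α v : ℝ} (hα0 : 0 < α) (hα1 : α ≤ 1) (hv : 0 < v) :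
    ∃ ξ, capacity (α * v) - α * capacity v = α * ξ ∧
      ξ = Real.log (1 + α * v) / α / 2 - capacity v ∧
      (1 - α) * v ^ 2 / (4 * (1 + v) * (1 + α * v)) ≤ ξ ∧ ξ ≤ (1 - α) * v ^ 2 / 4 := by
  have h : capacity (α * v) - α * capacity v =
      α * (Real.log (1 + α * v) / α / 2 - capacity v) := by
    rw [capacity]; field_simp
  refine ⟨_, h, rfl, ?_, ?_⟩
  · refine le_of_mul_le_mul_left ?_ hα0
    rw [← h]
    refine le_trans (Eq.le ?_) (capacity_gap_ge hα0.le hα1 hv.le)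
    ring
  · refine le_of_mul_le_mul_left ?_ hα0
    rw [← h]
    refine (capacity_gap_le hα0.le hα1 hv.le).trans (Eq.le ?_)
    ring

theorem direct_exponent {α : ℝ} (hn : 1 ≤ n) (hL : 2 ≤ L) (hS : 0 < S) (hS1 : S < 1 / 10)
    (hR0 : 0 < R) (hR : (L : ℝ) * Real.log M = n * R) (hM : (M : ℝ) = (L : ℝ) ^ a)
    (ha : aStar L S R ≤ a) (hΔ : Δ = capacity S - R) (hΔpos : 0 < Δ) (hk1 : 1 ≤ k) (hkL : k ≤ L)
    (hα : α = k / L) (hcase : 7 * (w S * α * S) ≤ Δ) (hε : ε ≤ α) :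
    ∃ lam, 0 ≤ lam ∧ lam ≤ 1 ∧
      Real.log (L.choose k) - n * (lam * (capacity (α * S) - α * R) - lam ^ 2 * (α * S) / 2) ≤
        Real.log 2 - n * h S ε Δ := by
  have hL0 : (0 : ℝ) < L := by positivity
  have hk0 : (0 : ℝ) < k := by exact_mod_cast hk1
  have hn0 : (0 : ℝ) < n := by exact_mod_cast hn
  have hα0 : 0 < α := by rw [hα]; positivity
  have hα1 : α ≤ 1 := by rw [hα, div_le_one hL0]; exact_mod_cast hkL
  have hlog2 : 0 ≤ Real.log 2 := Real.log_nonneg (by norm_num)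
  obtain ⟨ξ, hx, hξd, hξ1, hξ2⟩ := exists_gap_eq hα0 hα1 hS
  have hξ0 : 0 ≤ ξ := le_trans (by have := sub_nonneg.2 hα1; positivity) hξ1
  have hθ : capacity (α * S) - α * R = α * (ξ + Δ) := by rw [hΔ]; linarith
  have hC := capacity_le_half hS.le
  -- The maximiser of lam α(ξ + Δ) - lam² αS/2. It is at most 1 because ξ ≤ S²/4, Δ ≤ C ≤ S/2 and S
  -- < 1/10.
  refine ⟨(ξ + Δ) / S, by positivity, ?_, ?_⟩
  · rw [div_le_one hS]
    have : (1 - α) * S ^ 2 ≤ S ^ 2 := mul_le_of_le_one_left (by positivity) (by linarith)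
    nlinarith
  have hval : (ξ + Δ) / S * (α * (ξ + Δ)) - ((ξ + Δ) / S) ^ 2 * (α * S) / 2 =
      α * (ξ + Δ) ^ 2 / (2 * S) := by field_simp; ring
  rw [hθ, hval]
  have hh := mul_le_mul_of_nonneg_left (h_le_left hS hΔpos.le hε) hn0.le
  have hlc {j : ℕ} (hj1 : 1 ≤ j) (hjL : j < L) {β ζ : ℝ} (hβ : β = j / L)
      (hζ : capacity (β * S) - β * capacity S = β * ζ) :
      Real.log (L.choose j) ≤
        n * ((β * ζ) ^ 2 / (2 * (β * (1 - β) * S / (1 + β * S)))) := by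
    have hβ0 : 0 < β := by
      rw [hβ]; have : (0 : ℝ) < j := by exact_mod_cast hj1
      positivity
    have hβ1 : β < 1 := by rw [hβ, div_lt_one hL0]; exact_mod_cast hjL
    have h1β := sub_pos.2 hβ1
    obtain ⟨l, hl0, hl1, hl⟩ := log_choose_le hL hS hR0 hR hM ha hj1 hjL.le hβ
    refine hl.trans (mul_le_mul_of_nonneg_left ?_ hn0.le)
    rw [hζ]
    obtain ⟨hs0, hs1, -⟩ := gap_slope hS hβ0 hβ1
    refine mul_sub_le_sq_div hs0 ?_
    have hl0' : 0 ≤ l := le_trans (by have := w_pos hS; positivity) hl0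
    calc _ ≤ 1 * (β * (1 - β) * S / (1 + β * S)) := by
          gcongr; exact pow_le_one₀ hl0' hl1
      _ < 1 := by rw [one_mul]; exact hs1
  rcases hkL.eq_or_lt with rfl | hkL'
  · have h1 : α = 1 := by rw [hα, div_self hL0.ne']
    have h2 : ξ = 0 := by
      rw [h1] at hξ2; simp only [sub_self, zero_mul, zero_div] at hξ2; linarith
    have hr := mul_le_mul_of_nonneg_left (h_le_right (ε := ε) (Δ := Δ) hS) hn0.le
    have h3 : Δ ^ 2 / (8 * S) ≤ α * (ξ + Δ) ^ 2 / (2 * S) := by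
      rw [h1, h2, one_mul, zero_add]
      gcongr
      norm_num
    have h4 := mul_le_mul_of_nonneg_left h3 hn0.le
    simp only [Nat.choose_self, Nat.cast_one, Real.log_one]
    linarith
  have hα1' : α < 1 := by rw [hα, div_lt_one hL0]; exact_mod_cast hkL'
  rcases le_or_gt (1 / 20) α with hα20 | hα20
  · have h1 := hlc hk1 hkL' hα hx
    have h2 := direct_exponent_large hS hS1 hα20 hα1' hcase hξ1 hξ2 le_rfl
    have h3 := mul_le_mul_of_nonneg_left h2 hn0.le
    linarith
  · have h20 : 20 * k ≤ L := by
      rw [hα, div_lt_iff₀ hL0] at hα20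
      have : (20 : ℝ) * k ≤ L := by linarith
      exact_mod_cast this
    -- For small α the hypothesis on a is used only at β = 1/L, where it bounds log L itself.
    have hβ0 : (0 : ℝ) < (1 : ℕ) / L := by positivity
    have hβα : ((1 : ℕ) : ℝ) / L ≤ α := by rw [hα]; gcongr
    obtain ⟨ξ₁, hx₁, hξd₁, hξ₁, -⟩ := exists_gap_eq hβ0 (by linarith) hS
    have h1 := hlc le_rfl (by omega) rfl hx₁
    rw [Nat.choose_one_right] at h1
    have hd := log_div_sub_log_div_le hβ0 hβα hS.le
    have h2 := direct_exponent_small hS hS1 hβ0 hβα hα20 hn0.le hcase hξ1 hξ₁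
      (by rw [hξd, hξd₁]; linarith) h1
      (b := Real.log (L.choose k)) (by
        have := log_choose_le_of_twenty_mul_le hk1 h20
        rw [hα]
        convert this using 4
        field_simp
        push_cast
        ring)
    linarith

theorem weightEvent_le_two_mul_exp (hn : 1 ≤ n) (hL : 2 ≤ L) (hP : 0 < P) (hσ : 0 < σ)
    (hS : S = P / σ ^ 2) (hR : (L : ℝ) * Real.log M = n * R) (hM : (M : ℝ) = (L : ℝ) ^ a)
    (ha : aStar L S R ≤ a) (hΔ : Δ = capacity S - R) (hΔpos : 0 < Δ) (hk1 : 1 ≤ k) (hkL : k ≤ L)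
    (hε : ε ≤ k / L) (m : Fin L → Fin M) :
    ((dictionaryLaw n L M).prod (noiseLaw n σ)) (weightEvent n P k m) ≤
      ENNReal.ofReal (2 * Real.exp (-(n * h S ε Δ))) := by
  have hL0 : (0 : ℝ) < L := by positivity
  have hn0 : (0 : ℝ) < n := by exact_mod_cast hn
  have hS0 : 0 < S := by rw [hS]; positivity
  -- With fewer than two columns per section there is no competitor; otherwise R > 0, as needed to
  -- use the hypothesis on a.
  rcases lt_or_ge M 2 with hM2 | hM2
  · have hsub : Subsingleton (Fin M) := Fin.subsingleton_iff_le_one.2 (by omega)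
    have : weightEvent n P k m = ∅ := by
      ext p
      simp only [weightEvent, Set.mem_ofPred_eq, Set.mem_empty_iff_false, iff_false, not_exists,
        not_and]
      intro m' hm'
      rw [Subsingleton.elim m' m] at hm'
      simp at hm'
      omega
    rw [this, measure_empty]
    exact zero_le
  have hR0 : 0 < R := by
    have : 0 < Real.log M := Real.log_pos (by exact_mod_cast hM2)
    have : 0 < n * R := by rw [← hR]; positivity
    exact pos_of_mul_pos_right this hn0.le
  have hk0 : (0 : ℝ) < k := by exact_mod_cast hk1
  set α : ℝ := k / L with hα
  have hα0 : 0 < α := by positivity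
  have h2exp : 2 * Real.exp (-(n * h S ε Δ)) = Real.exp (Real.log 2 - n * h S ε Δ) := by
    rw [sub_eq_add_neg, Real.exp_add, Real.exp_log (by norm_num)]
  rw [h2exp]
  by_cases hcase : Δ ≤ 7 * (w S * α * S) ∨ 1 / 10 ≤ S
  · obtain ⟨l, hl0, hl1, hl⟩ := log_choose_le hL hS0 hR0 hR hM ha hk1 hkL hα
    obtain ⟨μ, hμ0, hμ1, hμ⟩ := exists_tilt hS0 hα0 hΔpos hcase (h_le_left hS0 hΔpos.le hε)
      (h_le_right hS0)
    refine (weightEvent_le_tilted hn (by omega) hM2 hkL hP hσ hS hα hR hl1 hμ0 (hμ1.trans hl0) hl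
      m).trans (ENNReal.ofReal_le_ofReal (Real.exp_le_exp.2 ?_))
    rw [← hΔ]
    have h1 := mul_le_mul_of_nonneg_left hμ hn0.le
    have : 0 ≤ Real.log 2 := Real.log_nonneg (by norm_num)
    linarith
  · push Not at hcase
    obtain ⟨lam, hl0, hl1, hl⟩ := direct_exponent hn hL hS0 hcase.2 hR0 hR hM ha hΔ hΔpos hk1 hkL hα
      hcase.1.le hε
    exact (weightEvent_le_direct hn (by omega) hM2 hkL hP hσ hS hα hR hl0 hl1 m).trans
      (ENNReal.ofReal_le_ofReal (Real.exp_le_exp.2 hl))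

end WeightEventBound

/-! ### From weight events to the decoder and the exponent. -/

section Decoder

variable {n L M : ℕ} {P σ S R a Δ ε : ℝ}

theorem sectionErrorRate_messageVector {c : ℝ} (hc : c ≠ 0) (m m' : Fin L → Fin M) :
    sectionErrorRate (messageVector c m) (messageVector c m') =
      ((Finset.univ.filter fun l => m' l ≠ m l).card : ℝ) / L := by
  have h (l : Fin L) : ((fun j => messageVector c m' (l, j)) ≠ fun j => messageVector c m (l, j)) ↔
      m' l ≠ m l := by
    refine not_congr ⟨fun heq => ?_, fun heq => by simp [messageVector, heq]⟩
    by_contra hne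
    have := congrFun heq (m' l)
    simp [messageVector, hne, hc] at this
  rw [sectionErrorRate]
  simp only [h]
  rw [Finset.sum_boole]
  ring

theorem excessProbOf_le (hn : 1 ≤ n) (hL : 2 ≤ L) (hP : 0 < P) (hσ : 0 < σ)
    (hS : S = P / σ ^ 2) (hR : (L : ℝ) * Real.log M = n * R) (hM : (M : ℝ) = (L : ℝ) ^ a)
    (ha : aStar L S R ≤ a) (hΔ : Δ = capacity S - R) (hΔpos : 0 < Δ)
    {dec : (Fin n → Fin L × Fin M → ℝ) → (Fin n → ℝ) → (Fin L × Fin M → ℝ)}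
    (hdec : IsMLDecoder (flatCoeff n L P) dec) (hε : 0 < ε) (m : Fin L → Fin M) :
    excessProbOf σ dec ε (messageVector (flatCoeff n L P) m) ≤
      ENNReal.ofReal (2 * L * Real.exp (-(n * h S ε Δ))) := by
  have hL0 : (0 : ℝ) < L := by positivity
  have hc : flatCoeff n L P ≠ 0 := by
    rw [flatCoeff]; positivity
  set K := (Finset.Icc 1 L).filter fun k : ℕ => ε ≤ (k : ℝ) / L with hK
  -- The decoder's output is itself a competitor at least as likely as the true message. Since ε >
  -- 0, an error rate of at least ε forces k ≥ 1.
  have hsub : {p : (Fin n → Fin L × Fin M → ℝ) × (Fin n → ℝ) |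
      ε ≤ sectionErrorRate (messageVector (flatCoeff n L P) m)
      (dec p.1 (codeword p.1 (messageVector (flatCoeff n L P) m) + p.2))} ⊆
      ⋃ k ∈ K, weightEvent n P k m := by
    intro p hp
    obtain ⟨hmem, hmin⟩ := hdec p.1 (codeword p.1 (messageVector (flatCoeff n L P) m) + p.2)
    obtain ⟨m', -, hm'⟩ := Finset.mem_image.1 hmem
    rw [Set.mem_ofPred_eq, ← hm', sectionErrorRate_messageVector hc] at hp
    refine Set.mem_iUnion₂.2 ⟨_, ?_, m', rfl, ?_⟩
    · rw [hK, Finset.mem_filter, Finset.mem_Icc]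
      refine ⟨⟨?_, ?_⟩, hp⟩
      · rw [Nat.one_le_iff_ne_zero]
        intro h0
        rw [h0] at hp
        simp only [Nat.cast_zero, zero_div] at hp
        linarith
      · simpa using Finset.card_le_univ (Finset.univ.filter fun l => m' l ≠ m l)
    · rw [hm']
      exact hmin _ (Finset.mem_image_of_mem _ (Finset.mem_univ m))
  rw [excessProbOf]
  calc _ ≤ ((dictionaryLaw n L M).prod (noiseLaw n σ)) (⋃ k ∈ K, weightEvent n P k m) :=
        measure_mono hsub
    _ ≤ ∑ k ∈ K, ((dictionaryLaw n L M).prod (noiseLaw n σ)) (weightEvent n P k m) :=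
        measure_biUnion_finset_le _ _
    _ ≤ ∑ _k ∈ K, ENNReal.ofReal (2 * Real.exp (-(n * h S ε Δ))) := by
        refine Finset.sum_le_sum fun k hk => ?_
        rw [hK, Finset.mem_filter, Finset.mem_Icc] at hk
        exact weightEvent_le_two_mul_exp hn hL hP hσ hS hR hM ha hΔ hΔpos hk.1.1 hk.1.2 hk.2 m
    _ = K.card * ENNReal.ofReal (2 * Real.exp (-(n * h S ε Δ))) := by
        rw [Finset.sum_const, nsmul_eq_mul]
    _ ≤ L * ENNReal.ofReal (2 * Real.exp (-(n * h S ε Δ))) := by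
        gcongr
        simpa using Finset.card_filter_le (Finset.Icc 1 L) fun k : ℕ => ε ≤ (k : ℝ) / L
    _ = _ := by
        rw [← ENNReal.ofReal_natCast, ← ENNReal.ofReal_mul hL0.le]
        congr 1
        ring

theorem excessProb_le (hn : 1 ≤ n) (hL : 2 ≤ L) (hP : 0 < P) (hσ : 0 < σ)
    (hS : S = P / σ ^ 2) (hR : (L : ℝ) * Real.log M = n * R) (hM : (M : ℝ) = (L : ℝ) ^ a)
    (ha : aStar L S R ≤ a) (hΔ : Δ = capacity S - R) (hΔpos : 0 < Δ)
    {dec : (Fin n → Fin L × Fin M → ℝ) → (Fin n → ℝ) → (Fin L × Fin M → ℝ)}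
    (hdec : IsMLDecoder (flatCoeff n L P) dec) (hε : 0 < ε) :
    excessProb σ (flatCoeff n L P) dec ε ≤
      ENNReal.ofReal (2 * L * Real.exp (-(n * h S ε Δ))) := by
  have hL0 : (0 : ℝ) < L := by positivity
  have hc : flatCoeff n L P ≠ 0 := by
    rw [flatCoeff]; positivity
  have hM0 : M ≠ 0 := by
    rintro rfl
    have := Real.rpow_pos_of_pos hL0 a
    rw [← hM] at this
    simp at this
  rw [excessProb]
  calc _ ≤ ((M : ℝ≥0∞) ^ L)⁻¹ * ∑ _β ∈ messageSet L M (flatCoeff n L P),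
        ENNReal.ofReal (2 * L * Real.exp (-(n * h S ε Δ))) := by
        gcongr with β hβ
        obtain ⟨m, -, rfl⟩ := Finset.mem_image.1 hβ
        exact excessProbOf_le hn hL hP hσ hS hR hM ha hΔ hΔpos hdec hε m
    _ = _ := by
        rw [Finset.sum_const, card_messageSet hc, nsmul_eq_mul, ← mul_assoc]
        push_cast
        rw [ENNReal.inv_mul_cancel (pow_ne_zero _ (by exact_mod_cast hM0))
          (ENNReal.pow_ne_top (ENNReal.natCast_ne_top M)), one_mul]

theorem exists_exponent (hn : 1 ≤ n) (hL : 1 ≤ L) {p : ℝ≥0∞} {η : ℝ}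
    (hp : p ≤ ENNReal.ofReal (2 * L * Real.exp (-(n * η)))) :
    ∃ E : EReal, p = EReal.exp (-((n : EReal) * E)) ∧
      ((η - Real.log (2 * L) / n : ℝ) : EReal) ≤ E := by
  have hn0 : (0 : ℝ) < n := by exact_mod_cast hn
  have hL0 : (0 : ℝ) < L := by exact_mod_cast hL
  -- Probability 0 corresponds to the exponent ⊤.
  rcases eq_or_ne p 0 with rfl | hp0
  · refine ⟨⊤, ?_, le_top⟩
    rw [EReal.mul_top_of_pos (by exact_mod_cast hn), EReal.neg_top, EReal.exp_bot]
  have hpt : p ≠ ⊤ := ne_top_of_le_ne_top ENNReal.ofReal_ne_top hp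
  have ht0 : 0 < p.toReal := ENNReal.toReal_pos hp0 hpt
  refine ⟨((-(Real.log p.toReal) / n : ℝ) : EReal), ?_, ?_⟩
  · have : -((n : EReal) * ((-(Real.log p.toReal) / n : ℝ) : EReal)) =
        ((Real.log p.toReal : ℝ) : EReal) := by
      rw [← EReal.coe_natCast, ← EReal.coe_mul, ← EReal.coe_neg]
      congr 1
      field_simp
    rw [this, EReal.exp_coe, Real.exp_log ht0, ENNReal.ofReal_toReal hpt]
  · rw [EReal.coe_le_coe_iff]
    have h1 : p.toReal ≤ 2 * L * Real.exp (-(n * η)) :=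
      ENNReal.toReal_le_of_le_ofReal (by positivity) hp
    have h2 := Real.log_le_log ht0 h1
    rw [Real.log_mul (by positivity) (Real.exp_pos _).ne', Real.log_exp] at h2
    have h3 : η - Real.log (2 * L) / n = (n * η - Real.log (2 * L)) / n := by field_simp
    rw [h3]
    gcongr
    linarith

end Decoder

end SPARC

theorem mainTheorem1 (n L M : ℕ) (hn : 1 ≤ n) (hL : 2 ≤ L)
    (P σ : ℝ) (hP : 0 < P) (hσ : 0 < σ)
    (snr : ℝ) (hsnr : snr = P / σ ^ 2)
    (R : ℝ) (hR : (L : ℝ) * Real.log M = n * R)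
    (a : ℝ) (hM : (M : ℝ) = (L : ℝ) ^ a) (ha : SPARC.aStar L snr R ≤ a)
    (Δ : ℝ) (hΔ : Δ = SPARC.capacity snr - R) (hΔpos : 0 < Δ)
    (dec : (Fin n → Fin L × Fin M → ℝ) → (Fin n → ℝ) → (Fin L × Fin M → ℝ))
    (hdec : SPARC.IsMLDecoder (SPARC.flatCoeff n L P) dec)
    (ε : ℝ) (hε : 0 < ε) :
    ∃ E : EReal,
      SPARC.excessProb σ (SPARC.flatCoeff n L P) dec ε = EReal.exp (-((n : EReal) * E)) ∧
      ((SPARC.h snr ε Δ - Real.log (2 * L) / n : ℝ) : EReal) ≤ E :=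
  SPARC.exists_exponent hn (by omega)
    (SPARC.excessProb_le hn hL hP hσ hsnr hR hM ha hΔ hΔpos hdec hε)
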